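/- Let $G$ be an undirected multigraph (parallel edges and loops allowed) with $n$ vertices, named $0,\dots,n-1$, whose edges are colored arbitrarily with colors named $0,\dots,C-1$. For a color $c$, let $G-c$ be the graph obtained from $G$ by deleting all edges of color $c$. For integers $n\ge 2$ put $L(n)=\lfloor\log_2\lfloor\log_2 n\rfloor\rfloor$, and put $L(1)=L(0)=0$. The model is the word RAM with $w$-bit words: in unit time the machine loads a constant, copies a register, adds, subtracts, multiplies or divides (quotient or remainder) two words, forms their bitwise and/or/xor, shifts a word, reads or writes a memory word whose address is in a register, or jumps to another line of its program if one register is smaller than (or equal to) another; all results are taken modulo $2^w$. A program is a finite list of such instructions. **Theorem.** There are a single program $P$ and constants $a,K\in\mathbb N$ such that, for all $n$ and $C$, every edge-colored multigraph $G$ as above and every word length $w\ge a(\lfloor\log_2(n+C)\rfloor+1)$, there is an oracle (a memory content) of at most $K\,n$ words of $w$ bits, for which the following holds: for all vertices $u,v$ and every color $c$, the program $P$, run on this memory with input $(u,v,c)$, halts after at most $K\,(L(n)+1)$ steps, reports correctly whether $u$ and $v$ are connected in $G-c$, and leaves the memory content as it was at the start. In particular, if $C$ is polynomially bounded in $n$,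 then words of $\Theta(\log n)$ bits suffice, the space is $O(n)$ words, and the query time is $O(\log\log n)$. The same holds for vertex-colored multigraphs, where $G-c$ is obtained from $G$ by deleting all vertices of color $c$ together with their incident edges, and a deleted vertex is not connected to any vertex. -/

import Mathlib

namespace WordRAM

/-- The binary operations that a word RAM carries out on two words in unit time. -/
inductive BinOp where
  | add | sub | mul | div | mod | and | or | xor | shl | shr

/-- The value of an operation on two `w`-bit words, i.e. natural numbers below `2 ^ w`. Results are
reduced modulo `2 ^ w`; division and remainder are rounded down (with the conventions
`x / 0 = 0` and `x % 0 = x`), the bitwise operations and the shifts act on binary expansions. -/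
def BinOp.eval (w : ℕ) (o : BinOp) (x y : ℕ) : ℕ :=
  (match o with
    | .add => x + y
    | .sub => x + 2 ^ w - y
    | .mul => x * y
    | .div => x / y
    | .mod => x % y
    | .and => x &&& y
    | .or => x ||| y
    | .xor => x ^^^ y
    | .shl => x <<< y
    | .shr => x >>> y) % 2 ^ w

/-- The instructions of a word RAM. Registers are named by natural numbers; as a program is a
finite list of instructions, it uses a constant number of them.
* `const d k`: put the constant `k` into register `d`;
* `move d s`: copy register `s` to register `d`;
* `op o d s t`: put the value of `o` on registers `s` and `t` into register `d`;
* `load d s`: put into register `d` the memory word whose address is in register `s`;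
* `store d s`: put register `s` into the memory word whose address is in register `d`;
* `jumpLt s t l`, `jumpEq s t l`: go to line `l` if the content of register `s` is smaller than
  (is equal to) that of register `t`. -/
inductive Instr where
  | const (d k : ℕ)
  | move (d s : ℕ)
  | op (o : BinOp) (d s t : ℕ)
  | load (d s : ℕ)
  | store (d s : ℕ)
  | jumpLt (s t l : ℕ)
  | jumpEq (s t l : ℕ)

/-- A program is a finite list of instructions, numbered from `0`. -/
abbrev Program := List Instr

/-- A state of the machine: the program counter, the registers, and the memory, whose length never
changes during a computation. -/
structure State where
  pc : ℕ
  reg : ℕ → ℕ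
  mem : List ℕ

/-- The effect of one instruction on a machine with `w`-bit words. Addresses outside the memory
read as `0`, and writing to them has no effect. -/
def Instr.exec (w : ℕ) (s : State) : Instr → State
  | .const d k => ⟨s.pc + 1, Function.update s.reg d (k % 2 ^ w), s.mem⟩
  | .move d r => ⟨s.pc + 1, Function.update s.reg d (s.reg r), s.mem⟩
  | .op o d r t => ⟨s.pc + 1, Function.update s.reg d (o.eval w (s.reg r) (s.reg t)), s.mem⟩
  | .load d r => ⟨s.pc + 1, Function.update s.reg d (s.mem.getD (s.reg r) 0), s.mem⟩
  | .store d r => ⟨s.pc + 1, s.reg, s.mem.set (s.reg d) (s.reg r)⟩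
  | .jumpLt r t l => ⟨if s.reg r < s.reg t then l else s.pc + 1, s.reg, s.mem⟩
  | .jumpEq r t l => ⟨if s.reg r = s.reg t then l else s.pc + 1, s.reg, s.mem⟩

/-- The program has halted when the program counter is not the number of an instruction. -/
def Halted (P : Program) (s : State) : Prop := P.length ≤ s.pc

/-- One step of the computation of the program `P`, at unit cost; a halted machine stays as it
is. -/
def step (w : ℕ) (P : Program) (s : State) : State :=
  match P[s.pc]? with
  | none => s
  | some i => i.exec w s

/-- The state that is reached from `s` after `t` steps. -/
def run (w : ℕ) (P : Program) (t : ℕ) (s : State) : State := (step w P)^[t] s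

/-- The initial state for memory content `mem` and input words `x₀, x₁, x₂`, which are passed in
registers `0`, `1`, `2`. All other registers hold `0`. -/
def init (mem : List ℕ) (x₀ x₁ x₂ : ℕ) : State where
  pc := 0
  reg := fun i => if i = 0 then x₀ else if i = 1 then x₁ else if i = 2 then x₂ else 0
  mem := mem

/-- On a machine with `w`-bit words, memory content `mem` and inputs `x₀, x₁, x₂`, the program `P`
halts within `T` steps with the truth value of `p` (`1` for true, `0` for false) in register `0`,
and with the memory content as it was at the start. -/
def Decides (w : ℕ) (P : Program) (mem : List ℕ) (x₀ x₁ x₂ T : ℕ) (p : Prop) : Prop :=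
  Halted P (run w P T (init mem x₀ x₁ x₂)) ∧
    (run w P T (init mem x₀ x₁ x₂)).mem = mem ∧
    (p → (run w P T (init mem x₀ x₁ x₂)).reg 0 = 1) ∧
    (¬ p → (run w P T (init mem x₀ x₁ x₂)).reg 0 = 0)

end WordRAM

namespace ColorFault

/-- Two vertices are connected in the multigraph `H`: both belong to `H`, and a walk of `H` joins
them. -/
def ConnectedIn {α β : Type*} (H : Graph α β) (u v : α) : Prop :=
  u ∈ H.vertexSet ∧ v ∈ H.vertexSet ∧ Relation.ReflTransGen H.Adj u v

/-- The graph `G - c` for an edge coloring: all edges of color `c` are deleted. -/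
def minusEdgeColor {α β γ : Type*} (G : Graph α β) (color : β → γ) (c : γ) : Graph α β :=
  G.deleteEdges {e | color e = c}

/-- The graph `G - c` for a vertex coloring: all vertices of color `c` are deleted, together with
the edges at them. -/
def minusVertexColor {α β γ : Type*} (G : Graph α β) (color : α → γ) (c : γ) : Graph α β :=
  G.deleteVerts {x | color x = c}

/-- `mem` is the content of an oracle for the queries `Q u v c` (`u, v` vertices, `c` a color) on
a RAM with `w`-bit words, with query algorithm `P`: it consists of at most `S` words of `w` bits,
and `P` answers each query correctly within `T` steps (and leaves the oracle intact). -/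
def IsOracle (w : ℕ) (P : WordRAM.Program) (S T : ℕ) {n C : ℕ}
    (Q : Fin n → Fin n → Fin C → Prop) (mem : List ℕ) : Prop :=
  mem.length ≤ S ∧ (∀ x ∈ mem, x < 2 ^ w) ∧
    ∀ (u v : Fin n) (c : Fin C), WordRAM.Decides w P mem u v c T (Q u v c)

end ColorFault

/-! Run a walk through all vertices of each component of G, with at most twice as many positions as
vertices; laid end to end, the walks have N ≤ 2n positions. Charge every step to one color: that of
an edge chosen for it, or, for vertex colors, that of its first end. Suppose that c fails and u
survives. After the last step charged to c before the position of u, the walk is intact up to u, so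
u lies in the component of G - c that contains the end of that step, or the start of the walk if
there is no such step. Hence one label per step is enough for all colors together: the name of the
component of its end after the failure of its own color. Two surviving vertices of one component of
G are connected in G - c iff their labels agree (`exists_tour`, `exists_connectivity_oracle`).

What remains is to find the predecessor of a position among the positions of color c. If a color is
renamed by its first occurrence, the pairs (color, position) become N keys of O(log n) bits,
whatever C is, and one sorted array holds them (`lastLabel_eq_of_pred`). Every `gap`-th key is a
sample, and all binary prefixes of samples go into a dictionary. As `gap` = O(log n) is the number
of prefixes of a key, the dictionary has O(n) entries. Binary search for the longest prefix of the
query that is in the dictionary leads to a stretch of `gap` array entries (`exists_level`), and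
binary search in the stretch finds the predecessor. Both searches take O(log log n) rounds. The
dictionary is a two-level perfect hash table with constant lookup time and linear space
(`exists_perfect_hash`).

The query algorithm is written in a small loop language without stores, whose compilation to RAM
code is verified once (`Cmd.Exec.run_code`); its correctness is `runs_queryCmd`. -/

namespace WordRAM

/-! ### Compilation of expressions and loops to RAM code -/

/-- Arithmetic expressions over registers and memory. -/
inductive Expr where
  | var (x : ℕ)
  | const (k : ℕ)
  | bin (o : BinOp) (a b : Expr)
  | load (a : Expr)

namespace Expr

/-- The value of an expression for given memory and register contents. -/
def eval (w : ℕ) (mem : List ℕ) (σ : ℕ → ℕ) : Expr → ℕ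
  | var x => σ x
  | const k => k % 2 ^ w
  | bin o a b => o.eval w (eval w mem σ a) (eval w mem σ b)
  | load a => mem.getD (eval w mem σ a) 0

/-- Code that puts the value of an expression into register `t`, using registers from `t` on. -/
def code (t : ℕ) : Expr → List Instr
  | var x => [.move t x]
  | const k => [.const t k]
  | bin o a b => code t a ++ (code (t + 1) b ++ [.op o t t (t + 1)])
  | load a => code t a ++ [.load t t]

/-- The number of instructions in the code of an expression. -/
def size : Expr → ℕ
  | var _ => 1
  | const _ => 1
  | bin _ a b => size a + (size b + 1)
  | load a => size a + 1

/-- All variables of the expression are below `V`. -/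
def Below (V : ℕ) : Expr → Prop
  | var x => x < V
  | const _ => True
  | bin _ a b => Below V a ∧ Below V b
  | load a => Below V a

@[simp] theorem length_code (t : ℕ) (e : Expr) : (e.code t).length = e.size := by
  induction e generalizing t <;> simp_all [code, size]

end Expr

/-- Structured commands: assignments, sequences, and loops that repeat their body while a given
variable is positive after it. -/
inductive Cmd where
  | assign (x : ℕ) (e : Expr)
  | seq (c d : Cmd)
  | loop (c : Cmd) (x : ℕ)

namespace Cmd

/-- Code for a command, to be placed at line `o`, with auxiliary registers from `V` on. -/
def code (V : ℕ) : ℕ → Cmd → List Instr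
  | _, assign x e => e.code V ++ [.move x V]
  | o, seq c d => code V o c ++ code V (o + (code V o c).length) d
  | o, loop c x => code V o c ++ [.const V 0, .jumpLt V x o]

/-- All variables of the command are below `V`. -/
def Below (V : ℕ) : Cmd → Prop
  | assign x e => x < V ∧ e.Below V
  | seq c d => Below V c ∧ Below V d
  | loop c x => Below V c ∧ x < V

/-- `Exec w mem c σ σ' k`: the command `c` takes register contents `σ` to `σ'` in `k` steps. -/
inductive Exec (w : ℕ) (mem : List ℕ) : Cmd → (ℕ → ℕ) → (ℕ → ℕ) → ℕ → Prop
  | assign (x : ℕ) (e : Expr) (σ : ℕ → ℕ) :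
      Exec w mem (assign x e) σ (Function.update σ x (e.eval w mem σ)) (e.size + 1)
  | seq {c d : Cmd} {σ σ' σ'' : ℕ → ℕ} {k l : ℕ} (h : Exec w mem c σ σ' k)
      (h' : Exec w mem d σ' σ'' l) : Exec w mem (seq c d) σ σ'' (k + l)
  | loop_stop {c : Cmd} {x : ℕ} {σ σ' : ℕ → ℕ} {k : ℕ} (h : Exec w mem c σ σ' k)
      (hx : σ' x = 0) : Exec w mem (loop c x) σ σ' (k + 2)
  | loop_step {c : Cmd} {x : ℕ} {σ σ' σ'' : ℕ → ℕ} {k l : ℕ} (h : Exec w mem c σ σ' k)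
      (hx : 0 < σ' x) (h' : Exec w mem (loop c x) σ' σ'' l) :
      Exec w mem (loop c x) σ σ'' (k + 2 + l)

end Cmd

/-- The code `l` stands in the program `P` from line `o` on. -/
def CodeAt (P : Program) (o : ℕ) (l : List Instr) : Prop :=
  ∃ p q, P = p ++ l ++ q ∧ p.length = o

theorem CodeAt.left {P : Program} {o : ℕ} {l l' : List Instr} (h : CodeAt P o (l ++ l')) :
    CodeAt P o l := by
  obtain ⟨p, q, rfl, rfl⟩ := h
  exact ⟨p, l' ++ q, by simp, rfl⟩

theorem CodeAt.right {P : Program} {o : ℕ} {l l' : List Instr} (h : CodeAt P o (l ++ l')) :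
    CodeAt P (o + l.length) l' := by
  obtain ⟨p, q, rfl, rfl⟩ := h
  exact ⟨p ++ l, q, by simp, by simp⟩

theorem CodeAt.step {P : Program} {o : ℕ} {i : Instr} {l : List Instr} (h : CodeAt P o (i :: l))
    (w : ℕ) (ρ : ℕ → ℕ) (mem : List ℕ) : WordRAM.step w P ⟨o, ρ, mem⟩ = i.exec w ⟨o, ρ, mem⟩ := by
  obtain ⟨p, q, rfl, rfl⟩ := h
  simp [WordRAM.step]

theorem run_add (w : ℕ) (P : Program) (k l : ℕ) (s : State) :
    run w P (k + l) s = run w P l (run w P k s) := by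
  rw [run, add_comm, Function.iterate_add_apply]; rfl

theorem run_one (w : ℕ) (P : Program) (s : State) : run w P 1 s = step w P s := rfl

namespace Expr

theorem eval_congr {w : ℕ} {mem : List ℕ} {V : ℕ} {σ ρ : ℕ → ℕ} {e : Expr} (he : e.Below V)
    (h : ∀ x < V, ρ x = σ x) : e.eval w mem ρ = e.eval w mem σ := by
  induction e with
  | var x => exact h x he
  | const k => rfl
  | bin o a b iha ihb => simp only [eval]; rw [iha he.1, ihb he.2]
  | load a ih => simp only [eval]; rw [ih he]

/-- Registers from `t` on serve as a stack: the code never touches a register below `t`, so the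
value of a left operand in `t` survives the evaluation of the right operand from `t + 1` on. -/
theorem run_code (w : ℕ) (mem : List ℕ) (V : ℕ) {P : Program} (e : Expr) :
    ∀ {t o : ℕ} (ρ : ℕ → ℕ), e.Below V → V ≤ t → CodeAt P o (e.code t) →
    ∃ ρ', run w P e.size ⟨o, ρ, mem⟩ = ⟨o + e.size, ρ', mem⟩ ∧ ρ' t = e.eval w mem ρ ∧
      ∀ x < t, ρ' x = ρ x := by
  induction e with
  | var x =>
    intro t o ρ _ _ hc
    refine ⟨Function.update ρ t (ρ x), ?_, by simp [eval], fun y hy => by simp [hy.ne]⟩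
    exact hc.step w ρ mem
  | const k =>
    intro t o ρ _ _ hc
    refine ⟨Function.update ρ t (k % 2 ^ w), ?_, by simp [eval], fun y hy => by simp [hy.ne]⟩
    exact hc.step w ρ mem
  | bin f a b iha ihb =>
    intro t o ρ he ht hc
    obtain ⟨ρ₁, h₁, h₁t, h₁x⟩ := iha ρ he.1 ht hc.left
    have hc' := hc.right
    rw [length_code] at hc'
    obtain ⟨ρ₂, h₂, h₂t, h₂x⟩ := ihb ρ₁ he.2 (by omega) hc'.left
    have hc'' := hc'.right
    rw [length_code] at hc''
    refine ⟨Function.update ρ₂ t (f.eval w (ρ₂ t) (ρ₂ (t + 1))), ?_, ?_, ?_⟩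
    · simp only [size]
      rw [run_add, h₁, run_add, h₂, run_one, hc''.step]
      simp [Instr.exec, add_assoc]
    · rw [Function.update_self, h₂t, h₂x t (by omega), h₁t,
        eval_congr he.2 fun x hx => h₁x x (by omega)]
      rfl
    · intro x hx
      rw [Function.update_of_ne hx.ne, h₂x x (by omega), h₁x x hx]
  | load a ih =>
    intro t o ρ he ht hc
    obtain ⟨ρ₁, h₁, h₁t, h₁x⟩ := ih ρ he ht hc.left
    have hc' := hc.right
    rw [length_code] at hc'
    refine ⟨Function.update ρ₁ t (mem.getD (ρ₁ t) 0), ?_, ?_, ?_⟩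
    · simp only [size]
      rw [run_add, h₁, run_one, hc'.step]
      simp [Instr.exec, add_assoc]
    · rw [Function.update_self, h₁t]; rfl
    · intro x hx
      rw [Function.update_of_ne hx.ne, h₁x x hx]

end Expr

/-- Machine and abstract registers are compared only below `V`, since the registers above hold
leftovers of evaluated expressions. The number of machine steps is exactly the `k` of `Exec`, so
time bounds can be proved for commands. -/
theorem Cmd.Exec.run_code {w : ℕ} {mem : List ℕ} {c : Cmd} {σ σ' : ℕ → ℕ} {k : ℕ}
    (h : c.Exec w mem σ σ' k) {V : ℕ} {P : Program} :
    ∀ {o : ℕ} (ρ : ℕ → ℕ), c.Below V → CodeAt P o (c.code V o) → (∀ x < V, ρ x = σ x) →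
    ∃ ρ', run w P k ⟨o, ρ, mem⟩ = ⟨o + (c.code V o).length, ρ', mem⟩ ∧
      ∀ x < V, ρ' x = σ' x := by
  -- The loop test takes two instructions, which is the `+ 2` in `Exec`: it clears the scratch
  -- register `V` and compares it with `x`.
  have jump_back : ∀ {c : Cmd} {x o : ℕ} {ρ : ℕ → ℕ}, x < V →
      CodeAt P o ((Cmd.loop c x).code V o) →
      run w P 2 ⟨o + (c.code V o).length, ρ, mem⟩ =
        ⟨if 0 < ρ x then o else o + ((Cmd.loop c x).code V o).length,
          Function.update ρ V 0, mem⟩ := by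
    intro c x o ρ hx hc
    have h₁ := CodeAt.right hc
    have h₂ := CodeAt.right (l := [Instr.const V 0]) h₁
    rw [show (2 : ℕ) = 1 + 1 from rfl, run_add, run_one, run_one, h₁.step]
    simp only [Instr.exec]
    rw [show o + (c.code V o).length + 1
      = o + (c.code V o).length + [Instr.const V 0].length from rfl, h₂.step]
    simp [Instr.exec, Cmd.code, Function.update_of_ne hx.ne, add_assoc]
  induction h with
  | assign x e σ =>
    intro o ρ hb hc hρ
    obtain ⟨ρ₁, h₁, h₁t, h₁x⟩ := e.run_code w mem V ρ hb.2 le_rfl hc.left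
    have hc' := hc.right
    rw [Expr.length_code] at hc'
    refine ⟨Function.update ρ₁ x (ρ₁ V), ?_, ?_⟩
    · rw [run_add, h₁, run_one, hc'.step]
      simp [Instr.exec, Cmd.code, add_assoc]
    · intro y hy
      by_cases hyx : y = x
      · subst hyx
        rw [Function.update_self, Function.update_self, h₁t, Expr.eval_congr hb.2 hρ]
      · rw [Function.update_of_ne hyx, Function.update_of_ne hyx, h₁x y hy, hρ y hy]
  | seq _ _ ih ih' =>
    intro o ρ hb hc hρ
    obtain ⟨ρ₁, h₁, h₁x⟩ := ih ρ hb.1 hc.left hρ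
    obtain ⟨ρ₂, h₂, h₂x⟩ := ih' ρ₁ hb.2 hc.right h₁x
    refine ⟨ρ₂, ?_, h₂x⟩
    rw [run_add, h₁, h₂]
    simp [Cmd.code, add_assoc]
  | loop_stop _ hx ih =>
    intro o ρ hb hc hρ
    obtain ⟨ρ₁, h₁, h₁x⟩ := ih ρ hb.1 hc.left hρ
    refine ⟨Function.update ρ₁ V 0, ?_, fun y hy => ?_⟩
    · rw [run_add, h₁, jump_back hb.2 hc, h₁x _ hb.2, hx]; simp
    · rw [Function.update_of_ne hy.ne, h₁x y hy]
  | loop_step _ hx _ ih ih' =>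
    intro o ρ hb hc hρ
    obtain ⟨ρ₁, h₁, h₁x⟩ := ih ρ hb.1 hc.left hρ
    obtain ⟨ρ₂, h₂, h₂x⟩ := ih' (Function.update ρ₁ V 0) hb hc fun y hy => by
      rw [Function.update_of_ne hy.ne, h₁x y hy]
    refine ⟨ρ₂, ?_, h₂x⟩
    rw [run_add, run_add, h₁, jump_back hb.2 hc, h₁x _ hb.2, if_pos hx, h₂]

theorem run_of_halted {w : ℕ} {P : Program} {s : State} (h : Halted P s) (k : ℕ) :
    run w P k s = s := by
  have : step w P s = s := by
    unfold step
    rw [List.getElem?_eq_none h]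
  exact Function.iterate_fixed this k

/-- A terminating command yields a program that decides a query. -/
theorem Cmd.Exec.decides {w : ℕ} {mem : List ℕ} {c : Cmd} {x₀ x₁ x₂ k T V : ℕ} {σ' : ℕ → ℕ}
    {p : Prop} (h : c.Exec w mem (init mem x₀ x₁ x₂).reg σ' k) (hk : k ≤ T) (hV : 0 < V)
    (hb : c.Below V) (h₁ : p → σ' 0 = 1) (h₀ : ¬ p → σ' 0 = 0) :
    Decides w (c.code V 0) mem x₀ x₁ x₂ T p := by
  obtain ⟨ρ, hr, hρ⟩ := h.run_code (P := c.code V 0) (o := 0) _ hb ⟨[], [], by simp, rfl⟩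
    fun _ _ => rfl
  obtain ⟨l, rfl⟩ := Nat.exists_eq_add_of_le hk
  have hrun : run w (c.code V 0) (k + l) (init mem x₀ x₁ x₂) =
      ⟨(c.code V 0).length, ρ, mem⟩ := by
    rw [run_add]
    have : run w (c.code V 0) k (init mem x₀ x₁ x₂) = ⟨(c.code V 0).length, ρ, mem⟩ := by
      rw [zero_add] at hr; exact hr
    rw [this]
    exact run_of_halted (by simp [Halted]) l
  unfold Decides
  rw [hrun]
  exact ⟨by simp [Halted], rfl, fun hp => (hρ 0 hV).trans (h₁ hp),
    fun hp => (hρ 0 hV).trans (h₀ hp)⟩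

end WordRAM

/-! ### Universal hashing and two-level perfect hashing -/

namespace ColorFault

/-- The hash function with multiplier `a`, modulus `p` and range `s`. -/
def hash (p s a x : ℕ) : ℕ := a * x % p % s

/-- If `a` makes `x` and `y` collide, then `a * x % p - a * y % p` is a nonzero multiple of `s`
strictly between `-p` and `p`. There are `2 * ((p - 1) / s)` of these, and each belongs to at most
one `a`, because `x - y` is invertible modulo `p`. -/
theorem mul_card_hash_collision_le {p : ℕ} (hp : p.Prime) {s x y : ℕ} (hs : 0 < s) (hx : x < p)
    (hy : y < p) (hxy : x ≠ y) :
    s * ((Finset.Ico 1 p).filter fun a => hash p s a x = hash p s a y).card ≤ 2 * (p - 1) := by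
  have := Fact.mk hp
  set D : Finset ℤ := (Finset.Icc (-(((p - 1) / s : ℕ) : ℤ)) ((p - 1) / s : ℕ)).erase 0 with hD
  have hp0 : (0 : ℤ) < p := by exact_mod_cast hp.pos
  have hs0 : (0 : ℤ) < s := by exact_mod_cast hs
  let f : ℕ → ℤ := fun a => ((a * x % p : ℕ) : ℤ) - ((a * y % p : ℕ) : ℤ)
  have hcast : ∀ a, ((f a : ℤ) : ZMod p) = (a : ZMod p) * ((x : ZMod p) - y) := by
    intro a
    simp [f, mul_sub]
  have hne : ((x : ZMod p) - y) ≠ 0 := by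
    intro h
    have h' : (x : ZMod p) = y := sub_eq_zero.mp h
    rw [ZMod.natCast_eq_natCast_iff'] at h'
    rw [Nat.mod_eq_of_lt hx, Nat.mod_eq_of_lt hy] at h'
    exact hxy h'
  have hinj : ∀ a < p, ∀ b < p, f a = f b → a = b := by
    intro a ha b hb hab
    have h : (a : ZMod p) * ((x : ZMod p) - y) = (b : ZMod p) * ((x : ZMod p) - y) := by
      rw [← hcast, ← hcast, hab]
    have h' := mul_right_cancel₀ hne h
    rw [ZMod.natCast_eq_natCast_iff', Nat.mod_eq_of_lt ha, Nat.mod_eq_of_lt hb] at h'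
    exact h'
  have hcard : ((Finset.Ico 1 p).filter fun a => hash p s a x = hash p s a y).card ≤ D.card := by
    refine Finset.card_le_card_of_injOn (fun a => f a / s) ?_ ?_
    · intro a ha
      simp only [Finset.coe_filter, Finset.mem_Ico, Set.mem_ofPred_eq] at ha
      obtain ⟨⟨ha1, hap⟩, hcol⟩ := ha
      have hdvd : (s : ℤ) ∣ f a := by
        have : (a * y % p : ℕ) ≡ (a * x % p : ℕ) [MOD s] := hcol.symm
        exact (Nat.modEq_iff_dvd).mp this
      obtain ⟨j, hj⟩ := hdvd
      -- The multiplier `0` already has difference `0`, so by injectivity no other multiplier has.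
      have hf0 : f a ≠ 0 := by
        intro h0
        have := hinj a hap 0 hp.pos (by rw [h0]; simp [f])
        omega
      have h1 : (a * x % p : ℕ) < p := Nat.mod_lt _ hp.pos
      have h2 : (a * y % p : ℕ) < p := Nat.mod_lt _ hp.pos
      have hlt : |f a| ≤ ((p - 1 : ℕ) : ℤ) := by
        rw [abs_le]; simp only [f]; omega
      simp only [Finset.mem_coe, hD, Finset.mem_erase, Finset.mem_Icc]
      rw [hj, Int.mul_ediv_cancel_left _ hs0.ne']
      have hj0 : j ≠ 0 := by rintro rfl; simp [hj] at hf0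
      refine ⟨hj0, ?_⟩
      rw [← abs_le, Int.natCast_div, Int.le_ediv_iff_mul_le hs0]
      rw [hj, abs_mul, abs_of_pos hs0] at hlt
      linarith
    · intro a ha b hb hab
      simp only [Finset.coe_filter, Finset.mem_Ico, Set.mem_ofPred_eq] at ha hb
      have hda : (s : ℤ) ∣ f a := (Nat.modEq_iff_dvd).mp (show (a * y % p) ≡ _ [MOD s] from ha.2.symm)
      have hdb : (s : ℤ) ∣ f b := (Nat.modEq_iff_dvd).mp (show (b * y % p) ≡ _ [MOD s] from hb.2.symm)
      exact hinj a ha.1.2 b hb.1.2 ((Int.ediv_left_inj hda hdb).mp hab)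
  have hDcard : D.card = 2 * ((p - 1) / s) := by
    rw [hD, Finset.card_erase_of_mem (by simp; positivity), Int.card_Icc]
    omega
  calc _ ≤ s * D.card := Nat.mul_le_mul_left _ hcard
    _ = 2 * (s * ((p - 1) / s)) := by rw [hDcard]; ring
    _ ≤ 2 * (p - 1) := Nat.mul_le_mul_left _ (Nat.mul_div_le _ _)

/-- Some multiplier has at most the average number of collisions. -/
theorem exists_hash_few_collisions {p : ℕ} (hp : p.Prime) {s : ℕ} (hs : 0 < s) (S : Finset ℕ)
    (hS : ∀ x ∈ S, x < p) :
    ∃ a < p, s * (S.offDiag.filter fun z => hash p s a z.1 = hash p s a z.2).card ≤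
      2 * S.offDiag.card := by
  by_contra! hcon
  have hp2 := hp.two_le
  have h1 : ∑ a ∈ Finset.Ico 1 p, (2 * S.offDiag.card) <
      ∑ a ∈ Finset.Ico 1 p,
        s * (S.offDiag.filter fun z => hash p s a z.1 = hash p s a z.2).card := by
    refine Finset.sum_lt_sum_of_nonempty ⟨1, by simp; omega⟩ fun a ha => ?_
    exact hcon a (Finset.mem_Ico.mp ha).2
  have h2 : ∑ a ∈ Finset.Ico 1 p,
        s * (S.offDiag.filter fun z => hash p s a z.1 = hash p s a z.2).card =
      ∑ z ∈ S.offDiag,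
        s * ((Finset.Ico 1 p).filter fun a => hash p s a z.1 = hash p s a z.2).card := by
    simp only [Finset.card_filter, ← Finset.mul_sum]
    rw [Finset.sum_comm]
  have h3 : ∑ z ∈ S.offDiag,
        s * ((Finset.Ico 1 p).filter fun a => hash p s a z.1 = hash p s a z.2).card ≤
      ∑ z ∈ S.offDiag, 2 * (p - 1) := by
    refine Finset.sum_le_sum fun z hz => ?_
    rw [Finset.mem_offDiag] at hz
    exact mul_card_hash_collision_le hp hs (hS _ hz.1) (hS _ hz.2.1) hz.2.2
  rw [h2] at h1
  have h4 := h1.trans_le h3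
  simp only [Finset.sum_const, smul_eq_mul, Nat.card_Ico] at h4
  exact absurd h4 (by rw [not_lt]; exact le_of_eq (by ring))

/-- A range larger than twice the number of ordered pairs pushes the average number of collisions
below one. -/
theorem exists_hash_injOn {p : ℕ} (hp : p.Prime) (S : Finset ℕ) (hS : ∀ x ∈ S, x < p) :
    ∃ a < p, Set.InjOn (hash p (2 * S.card ^ 2 + 1) a) S := by
  obtain ⟨a, hap, ha⟩ := exists_hash_few_collisions hp (s := 2 * S.card ^ 2 + 1) (by omega) S hS
  refine ⟨a, hap, fun x hx y hy hxy => ?_⟩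
  by_contra hne
  have hpos : 0 < (S.offDiag.filter fun z => hash p (2 * S.card ^ 2 + 1) a z.1 =
      hash p (2 * S.card ^ 2 + 1) a z.2).card :=
    Finset.card_pos.mpr ⟨(x, y), by
      simp only [Finset.mem_filter, Finset.mem_offDiag]; exact ⟨⟨hx, hy, hne⟩, hxy⟩⟩
  have h1 : S.offDiag.card ≤ S.card ^ 2 := by
    rw [Finset.offDiag_card, sq]; omega
  nlinarith

/-- The place of `x` in a two-level hash table. -/
def slot (p s a : ℕ) (A S O : ℕ → ℕ) (x : ℕ) : ℕ :=
  O (hash p s a x) + hash p (S (hash p s a x)) (A (hash p s a x)) x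

/-- Two-level perfect hashing with linear space. -/
theorem exists_perfect_hash {p : ℕ} (hp : p.Prime) (X : Finset ℕ) (hX : ∀ x ∈ X, x < p)
    (hX0 : X.Nonempty) :
    ∃ (a : ℕ) (A S O : ℕ → ℕ), a < p ∧ (∀ i, A i < p) ∧ (∀ i < X.card, 0 < S i ∧ S i ≤ 7 * X.card)
      ∧ (∀ i < X.card, O i ≤ 7 * X.card) ∧
      (∀ x, slot p X.card a A S O x < 7 * X.card) ∧
      Set.InjOn (slot p X.card a A S O) X := by
  have hk : 0 < X.card := hX0.card_pos
  obtain ⟨a, hap, ha⟩ := exists_hash_few_collisions hp hk X hX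
  set s := X.card with hs
  set B : ℕ → Finset ℕ := fun i => X.filter fun x => hash p s a x = i with hB
  have hmaps : ∀ x, hash p s a x < s := fun x => Nat.mod_lt _ hk
  choose A hA hinj using fun i => exists_hash_injOn hp (B i) fun x hx =>
    hX x (Finset.mem_filter.mp hx).1
  set S : ℕ → ℕ := fun i => 2 * (B i).card ^ 2 + 1 with hSdef
  set O : ℕ → ℕ := fun i => ∑ j ∈ Finset.range i, S j with hO
  have hsumcard : ∑ i ∈ Finset.range s, (B i).card = s := by
    rw [hs]
    exact (Finset.card_eq_sum_card_fiberwise (f := hash p s a) (t := Finset.range s)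
      fun x _ => by simpa using hmaps x).symm
  -- The squares count the ordered pairs within buckets: at most `2 * s` colliding pairs of distinct
  -- keys, and `s` pairs of equal ones. With `S i = 2 * (B i).card ^ 2 + 1` the second level thus
  -- needs at most `2 * 3 * s + s` places.
  have hsumsq : ∑ i ∈ Finset.range s, (B i).card ^ 2 ≤ 3 * s := by
    have h1 : (X.offDiag.filter fun z => hash p s a z.1 = hash p s a z.2).card =
        ∑ i ∈ Finset.range s, (B i).offDiag.card := by
      rw [Finset.card_eq_sum_card_fiberwise (f := fun z : ℕ × ℕ => hash p s a z.1)
        (t := Finset.range s) fun x _ => by simpa using hmaps x.1]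
      refine Finset.sum_congr rfl fun i _ => ?_
      congr 1
      ext ⟨x, y⟩
      simp only [hB, Finset.mem_filter, Finset.mem_offDiag]
      constructor
      · rintro ⟨⟨⟨h1, h2, h3⟩, h4⟩, h5⟩
        exact ⟨⟨h1, h5⟩, ⟨h2, h4 ▸ h5⟩, h3⟩
      · rintro ⟨⟨h1, h5⟩, ⟨h2, h4⟩, h3⟩
        exact ⟨⟨⟨h1, h2, h3⟩, h5.trans h4.symm⟩, h5⟩
    have h2 : ∑ i ∈ Finset.range s, (B i).card ^ 2 =
        ∑ i ∈ Finset.range s, (B i).offDiag.card + ∑ i ∈ Finset.range s, (B i).card := by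
      rw [← Finset.sum_add_distrib]
      refine Finset.sum_congr rfl fun i _ => ?_
      rw [Finset.offDiag_card, sq, Nat.sub_add_cancel (Nat.le_mul_self _)]
    rw [h2, ← h1, hsumcard]
    have h3 : X.offDiag.card ≤ s * s := by
      rw [Finset.offDiag_card]; exact Nat.sub_le _ _
    have h4 : s * (X.offDiag.filter fun z => hash p s a z.1 = hash p s a z.2).card ≤
        s * (2 * s) := ha.trans (by nlinarith)
    have := Nat.le_of_mul_le_mul_left h4 hk
    omega
  have hOs : O s ≤ 7 * s := by
    simp only [hO, hSdef, Finset.sum_add_distrib, ← Finset.mul_sum]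
    simp
    omega
  have hmono : ∀ i j, i ≤ j → O i ≤ O j := fun i j hij =>
    Finset.sum_le_sum_of_subset (Finset.range_subset_range.mpr hij)
  have hOsucc : ∀ i, O (i + 1) = O i + S i := fun i => Finset.sum_range_succ _ _
  have hSpos : ∀ i, 0 < S i := fun i => Nat.succ_pos _
  have hin : ∀ i x, hash p (S i) (A i) x < S i := fun i x => Nat.mod_lt _ (hSpos i)
  refine ⟨a, A, S, O, hap, hA, fun i hi => ⟨hSpos i, ?_⟩, fun i hi => (hmono i s hi.le).trans hOs,
    fun x => ?_, ?_⟩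
  · have := hmono (i + 1) s hi
    rw [hOsucc] at this; omega
  · have := hmono (hash p s a x + 1) s (hmaps x)
    rw [hOsucc] at this
    have := hin (hash p s a x) x
    unfold slot; omega
  · intro x hx y hy hxy
    have key : hash p s a x = hash p s a y := by
      by_contra hne
      -- Different buckets own disjoint intervals of places.
      have aux : ∀ x y, slot p s a A S O x = slot p s a A S O y →
          ¬ hash p s a x < hash p s a y := by
        intro x y hxy hlt
        have h1 := hmono _ _ (Nat.succ_le_of_lt hlt)
        rw [Nat.succ_eq_add_one, hOsucc] at h1
        have := hin (hash p s a x) x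
        unfold slot at hxy; omega
      rcases Nat.lt_or_gt_of_ne hne with h | h
      · exact aux x y hxy h
      · exact aux y x hxy.symm h
    unfold slot at hxy
    rw [← key] at hxy
    exact hinj (hash p s a x) (by simpa [hB] using hx) (by simpa [hB, key] using hy)
      (Nat.add_left_cancel hxy)

end ColorFault

/-! ### Predecessor search with sampled prefixes -/

namespace ColorFault

section Count

variable {p : ℕ → Prop} [DecidablePred p]

theorem nth_of_lt_count {k Z : ℕ} (h : k < Nat.count p Z) :
    Nat.nth p k < Z ∧ p (Nat.nth p k) ∧ Nat.count p (Nat.nth p k) = k := by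
  have hf : ∀ hf : (Set.ofPred p).Finite, k < hf.toFinset.card := by
    intro hf
    refine h.trans_le ?_
    rw [Nat.count_eq_card_filter_range]
    exact Finset.card_le_card fun x hx => by
      rw [Set.Finite.mem_toFinset]; exact (Finset.mem_filter.mp hx).2
  exact ⟨Nat.nth_lt_of_lt_count h, Nat.nth_mem k hf, Nat.count_nth hf⟩

/-- Between two numbers without a sampled element in between, the number of samples is constant. -/
theorem count_pred_div_eq {q Z₁ Z₂ : ℕ} (h : Z₁ ≤ Z₂)
    (hno : ∀ s, Z₁ ≤ s → s < Z₂ → p s → ¬ q ∣ Nat.count p s) :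
    (Nat.count p Z₁ - 1) / q = (Nat.count p Z₂ - 1) / q := by
  rcases Nat.eq_zero_or_pos q with rfl | hq
  · simp
  have hmono := Nat.count_monotone p h
  by_contra hne
  have hlt : (Nat.count p Z₁ - 1) / q < (Nat.count p Z₂ - 1) / q :=
    lt_of_le_of_ne (Nat.div_le_div_right (by omega)) hne
  set j := (Nat.count p Z₂ - 1) / q with hj
  have h1 : j * q ≤ Nat.count p Z₂ - 1 := Nat.div_mul_le_self _ _
  have hjq : 0 < j * q := Nat.mul_pos (Nat.zero_lt_of_lt hlt) hq
  -- If the quotients differed, the element of rank `j * q` would be a sample between `Z₁` and `Z₂`.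
  obtain ⟨ha, hb, hc⟩ := nth_of_lt_count (p := p) (k := j * q) (Z := Z₂) (by omega)
  refine hno _ ?_ ha hb ⟨j, by rw [hc, mul_comm]⟩
  by_contra! hs
  have h2 := Nat.count_strict_mono hb hs
  rw [hc] at h2
  have : j ≤ (Nat.count p Z₁ - 1) / q := (Nat.le_div_iff_mul_le hq).mpr (by omega)
  omega

/-- The elements of `p` below `E` as an increasing sequence, indexed from `1`, followed by `E`. -/
noncomputable def sortedArray (p : ℕ → Prop) [DecidablePred p] (E i : ℕ) : ℕ :=
  if i ≤ Nat.count p E then Nat.nth p (i - 1) else E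

/-- This is the test of the binary search in the array. The padding with `E` lets it fail beyond the
last element, so the search may probe there. -/
theorem sortedArray_lt_iff {E X i : ℕ} (hX : X ≤ E) (hi : 0 < i) :
    sortedArray p E i < X ↔ i ≤ Nat.count p X := by
  have hmono := Nat.count_monotone p hX
  unfold sortedArray
  split_ifs with h
  · obtain ⟨ha, hb, hc⟩ := nth_of_lt_count (p := p) (k := i - 1) (Z := E) (by omega)
    constructor
    · intro hlt
      have := Nat.count_strict_mono hb hlt
      omega
    · intro hle
      exact (nth_of_lt_count (p := p) (k := i - 1) (Z := X) (by omega)).1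
  · omega

theorem sortedArray_le {E i : ℕ} (hi : 0 < i) : sortedArray p E i ≤ E := by
  unfold sortedArray
  split_ifs with h
  · exact (nth_of_lt_count (p := p) (k := i - 1) (Z := E) (by omega)).1.le
  · exact le_rfl

theorem sortedArray_count {E X : ℕ} (hX : X ≤ E) (h0 : 0 < Nat.count p X) :
    sortedArray p E (Nat.count p X) < X ∧ p (sortedArray p E (Nat.count p X)) ∧
      ∀ y, sortedArray p E (Nat.count p X) < y → y < X → ¬ p y := by
  unfold sortedArray
  rw [if_pos (Nat.count_monotone p hX)]
  obtain ⟨ha, hb, hc⟩ := nth_of_lt_count (p := p) (k := Nat.count p X - 1) (Z := X) (by omega)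
  refine ⟨ha, hb, fun y hy hyX hp => ?_⟩
  have h1 := Nat.count_strict_mono hb hy
  have h2 := Nat.count_strict_mono hp hyX
  omega

/-- The prefixes of the sampled elements below `2 ^ (B + 1)`. -/
def prefixes (p : ℕ → Prop) [DecidablePred p] (q B : ℕ) : Finset ℕ :=
  (((Finset.range (2 ^ (B + 1))).filter fun s => p s ∧ q ∣ Nat.count p s) ×ˢ
    Finset.range (B + 2)).image fun z => z.1 / 2 ^ z.2

/-- The start of the stretch of the sorted array to which the sample before `Z` leads. -/
def stretch (p : ℕ → Prop) [DecidablePred p] (q Z : ℕ) : ℕ := q * ((Nat.count p Z - 1) / q)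

theorem stretch_le (q Z : ℕ) : stretch p q Z ≤ Nat.count p Z :=
  (Nat.mul_div_le _ _).trans (Nat.sub_le _ _)

theorem count_le_stretch_add {q : ℕ} (hq : 0 < q) (Z : ℕ) :
    Nat.count p Z ≤ stretch p q Z + q := by
  have := Nat.lt_mul_div_succ (Nat.count p Z - 1) hq
  unfold stretch
  rw [Nat.mul_succ] at this
  omega

/-- Each sample has `B + 2` prefixes, counting the empty one; a sampling distance of at least this
size makes the prefixes no more numerous than the elements, up to one extra `q`. -/
theorem card_prefixes_le {q B : ℕ} (hB : B + 2 ≤ q) :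
    (prefixes p q B).card ≤ Nat.count p (2 ^ (B + 1)) + q := by
  set m := Nat.count p (2 ^ (B + 1)) with hm
  have h1 : ((Finset.range (2 ^ (B + 1))).filter fun s => p s ∧ q ∣ Nat.count p s).card ≤
      (Finset.range (m / q + 1)).card := by
    refine Finset.card_le_card_of_injOn (fun s => Nat.count p s / q) ?_ ?_
    · intro s hs
      simp only [Finset.coe_filter, Finset.mem_range, Set.mem_ofPred_eq] at hs
      simp only [Finset.coe_range, Set.mem_Iio, Nat.lt_succ_iff]
      exact Nat.div_le_div_right (Nat.count_monotone p hs.1.le)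
    · intro s hs t ht hst
      simp only [Finset.coe_filter, Finset.mem_range, Set.mem_ofPred_eq] at hs ht
      exact Nat.count_injective hs.2.1 ht.2.1 ((Nat.div_left_inj hs.2.2 ht.2.2).mp hst)
  refine Finset.card_image_le.trans ?_
  rw [Finset.card_product, Finset.card_range]
  rw [Finset.card_range] at h1
  calc _ ≤ (m / q + 1) * q := Nat.mul_le_mul h1 hB
    _ ≤ m + q := by rw [add_mul, one_mul]; exact Nat.add_le_add_right (Nat.div_mul_le_self _ _) _

theorem le_of_mem_prefixes {q B y : ℕ} (hy : y ∈ prefixes p q B) : y < 2 ^ (B + 1) := by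
  simp only [prefixes, Finset.mem_image, Finset.mem_product, Finset.mem_filter,
    Finset.mem_range] at hy
  obtain ⟨z, hz, rfl⟩ := hy
  exact (Nat.div_le_self _ _).trans_lt hz.1.1

/-- All keys have their leading bit at place `B`, so a nonzero prefix, taken as a number, reveals
how many bits were cut off. Nonzero prefixes of different lengths therefore never coincide, and data
about a prefix can be filed under its value alone. -/
theorem log_div_two_pow {B X t : ℕ} (h1 : 2 ^ B ≤ X) (h2 : X < 2 ^ (B + 1)) :
    Nat.log 2 (X / 2 ^ t) = B - t := by
  rw [Nat.log_div_base_pow, Nat.log_eq_of_pow_le_of_lt_pow h1 h2]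

variable {q B X : ℕ}

theorem div_mem_prefixes_iff (hp : ∀ s, p s → 2 ^ B ≤ s ∧ s < 2 ^ (B + 1)) (h1 : 2 ^ B ≤ X)
    (h2 : X < 2 ^ (B + 1)) (t : ℕ) :
    X / 2 ^ t ∈ prefixes p q B ↔
      ∃ s, p s ∧ q ∣ Nat.count p s ∧ s / 2 ^ t = X / 2 ^ t := by
  have hzero : ∀ x t, x < 2 ^ (B + 1) → B < t → x / 2 ^ t = 0 := fun x t hx ht =>
    Nat.div_eq_of_lt (hx.trans_le (Nat.pow_le_pow_right two_pos ht))
  simp only [prefixes, Finset.mem_image, Finset.mem_product, Finset.mem_filter,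
    Finset.mem_range, Prod.exists]
  constructor
  · rintro ⟨s, t', ⟨⟨hs, hps, hqs⟩, ht'⟩, hst⟩
    refine ⟨s, hps, hqs, ?_⟩
    -- For `t ≤ B` the prefix is nonzero and determines its length, so `t = t'`; for larger `t` all
    -- prefixes are `0`.
    rcases le_or_gt t B with ht | ht
    · have hpos : 0 < X / 2 ^ t :=
        Nat.div_pos ((Nat.pow_le_pow_right two_pos ht).trans h1) (by positivity)
      have ht'B : t' ≤ B := by
        by_contra! hlt
        rw [hzero s t' hs hlt] at hst
        omega
      have h3 := log_div_two_pow (t := t) h1 h2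
      rw [← hst, log_div_two_pow (hp s hps).1 hs] at h3
      rw [show t = t' by omega] at hst ⊢
      exact hst
    · rw [hzero s t hs ht, hzero X t h2 ht]
  · rintro ⟨s, hps, hqs, hst⟩
    rcases le_or_gt t B with ht | ht
    · exact ⟨s, t, ⟨⟨(hp s hps).2, hps, hqs⟩, by omega⟩, hst⟩
    · refine ⟨s, B + 1, ⟨⟨(hp s hps).2, hps, hqs⟩, by omega⟩, ?_⟩
      rw [hzero s _ (hp s hps).2 (by omega), hzero X t h2 ht]

/-- Binary search on the length of the longest common prefix with a sample: the prefixes of `X`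
that occur are those from some length `level` down, and the next bit of `X` tells the stretch. -/
theorem exists_level (hp : ∀ s, p s → 2 ^ B ≤ s ∧ s < 2 ^ (B + 1)) (h1 : 2 ^ B ≤ X)
    (h2 : X < 2 ^ (B + 1)) (h0 : p (2 ^ B)) :
    ∃ t ≤ B, (∀ t', X / 2 ^ t' ∈ prefixes p q B ↔ t ≤ t') ∧
      stretch p q ((X / 2 ^ t + 2 * X / 2 ^ t % 2) * 2 ^ (B - Nat.log 2 (X / 2 ^ t))) =
        stretch p q X := by
  have hc0 : Nat.count p (2 ^ B) = 0 := by
    rw [Nat.count_eq_card_filter_range, Finset.card_eq_zero, Finset.filter_eq_empty_iff]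
    intro x hx hpx
    have := (hp x hpx).1
    rw [Finset.mem_range] at hx
    omega
  -- The element `2 ^ B` has rank `0` and so is a sample; its leading bit is the prefix `1` of every
  -- `X`. Hence the search has a solution.
  have hBmem : X / 2 ^ B ∈ prefixes p q B := by
    rw [div_mem_prefixes_iff hp h1 h2]
    refine ⟨2 ^ B, h0, by rw [hc0]; exact dvd_zero _, ?_⟩
    rw [Nat.div_self (by positivity)]
    symm
    rw [Nat.div_eq_iff (by positivity)]
    rw [pow_succ] at h2
    omega
  have hex : ∃ t, X / 2 ^ t ∈ prefixes p q B := ⟨B, hBmem⟩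
  classical
  have htB : Nat.find hex ≤ B := Nat.find_min' hex hBmem
  have hmin : ∀ t' < Nat.find hex, X / 2 ^ t' ∉ prefixes p q B := fun t' => Nat.find_min hex
  have hspec := Nat.find_spec hex
  generalize Nat.find hex = t at *
  refine ⟨t, htB, fun t' => ⟨fun h => not_lt.mp fun h' => hmin t' h' h, fun h => ?_⟩, ?_⟩
  · rw [div_mem_prefixes_iff hp h1 h2] at hspec ⊢
    obtain ⟨s, hs, hqs, hst⟩ := hspec
    refine ⟨s, hs, hqs, ?_⟩
    obtain ⟨d, rfl⟩ := Nat.exists_eq_add_of_le h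
    rw [pow_add, ← Nat.div_div_eq_div_mul, ← Nat.div_div_eq_div_mul, hst]
  · rw [log_div_two_pow h1 h2, Nat.sub_sub_self htB]
    rcases Nat.eq_zero_or_pos t with rfl | ht
    -- If all of `X` occurs, the factor `2` makes the next bit `0`, and the point at which the
    -- stretch is taken is `X` itself.
    · simp
    obtain ⟨t, rfl⟩ : ∃ t', t = t' + 1 := ⟨t - 1, by omega⟩
    have hnot := hmin t (by omega)
    rw [div_mem_prefixes_iff hp h1 h2] at hnot
    push Not at hnot
    have e1 : 2 * X / 2 ^ (t + 1) = X / 2 ^ t := by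
      rw [pow_succ, mul_comm (2 ^ t), Nat.mul_div_mul_left _ _ two_pos]
    have e2 : X / 2 ^ (t + 1) = X / 2 ^ t / 2 := by rw [pow_succ, Nat.div_div_eq_div_mul]
    rw [e1, e2]
    -- `Y` is the shortest prefix of `X` that no sample has, so the interval of numbers with prefix
    -- `Y` contains no sample. Its left end (last bit `0`) or right end (last bit `1`) leads to the
    -- same stretch as `X`, and this end depends only on the longer cut `Y / 2` and the bit.
    set Y := X / 2 ^ t with hY
    have hpos : 0 < 2 ^ t := by positivity
    have hX1 : Y * 2 ^ t ≤ X := Nat.div_mul_le_self _ _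
    have hX2 : X < (Y + 1) * 2 ^ t := by
      rw [mul_comm]; exact Nat.lt_mul_div_succ X hpos
    have e3 : (Y / 2 + Y % 2) * 2 ^ (t + 1) = (2 * (Y / 2) + 2 * (Y % 2)) * 2 ^ t := by
      rw [pow_succ]; ring
    rw [e3]
    unfold stretch
    congr 1
    rcases Nat.mod_two_eq_zero_or_one Y with hb | hb
    · have e4 : 2 * (Y / 2) + 2 * (Y % 2) = Y := by omega
      rw [e4]
      refine count_pred_div_eq hX1 fun s hs1 hs2 hs hqs => hnot s hs hqs ?_
      exact (Nat.div_eq_of_lt_le hs1 (hs2.trans hX2))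
    · have e4 : 2 * (Y / 2) + 2 * (Y % 2) = Y + 1 := by omega
      rw [e4]
      refine (count_pred_div_eq hX2.le fun s hs1 hs2 hs hqs => hnot s hs hqs ?_).symm
      exact (Nat.div_eq_of_lt_le (hX1.trans hs1) hs2)

end Count

/-! ### Labels, and colored positions as keys -/

/-- The label that the last position `i` with `s ≤ i < r` and color `c` gives to position `r`; it
is `s` if there is no such position. -/
def lastLabel (κ T : ℕ → ℕ) (c s : ℕ) : ℕ → ℕ
  | 0 => s
  | r + 1 => if s ≤ r ∧ κ r = c then T r else lastLabel κ T c s r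

theorem lastLabel_of_last {κ T : ℕ → ℕ} {c s i r : ℕ} (hs : s ≤ i) (hr : i < r) (hi : κ i = c)
    (hlast : ∀ j, i < j → j < r → κ j ≠ c) : lastLabel κ T c s r = T i := by
  induction r with
  | zero => omega
  | succ r ih =>
    rw [lastLabel]
    rcases Nat.lt_succ_iff_lt_or_eq.mp hr with h | rfl
    · rw [if_neg fun h' => hlast r h (by omega) h'.2]
      exact ih h fun j hj hj' => hlast j hj (by omega)
    · rw [if_pos ⟨hs, hi⟩]

theorem lastLabel_of_none {κ T : ℕ → ℕ} {c s r : ℕ}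
    (hnone : ∀ j, s ≤ j → j < r → κ j ≠ c) : lastLabel κ T c s r = s := by
  induction r with
  | zero => rfl
  | succ r ih =>
    rw [lastLabel, if_neg fun h => hnone r h.1 (by omega) h.2]
    exact ih fun j hj hj' => hnone j hj (by omega)

open Classical in
/-- The first position below `N` that has color `c`, and `N` if there is none. -/
noncomputable def firstOcc (N : ℕ) (κ : ℕ → ℕ) (c : ℕ) : ℕ :=
  if h : ∃ i < N, κ i = c then Nat.find h else N

theorem firstOcc_le (N : ℕ) (κ : ℕ → ℕ) (c : ℕ) : firstOcc N κ c ≤ N := by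
  classical
  unfold firstOcc
  split_ifs with h
  · exact (Nat.find_spec h).1.le
  · exact le_rfl

theorem firstOcc_of_occurs {N : ℕ} {κ : ℕ → ℕ} {c : ℕ} (h : ∃ i < N, κ i = c) :
    firstOcc N κ c < N ∧ κ (firstOcc N κ c) = c := by
  classical
  unfold firstOcc
  rw [dif_pos h]
  exact Nat.find_spec h

theorem firstOcc_of_not_occurs {N : ℕ} {κ : ℕ → ℕ} {c : ℕ} (h : ¬ ∃ i < N, κ i = c) :
    firstOcc N κ c = N := by
  unfold firstOcc
  rw [dif_neg h]

/-- First occurrences name the colors by numbers up to `N`, so that the size of the key universe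
does not depend on the number of colors. All colors that do not occur share the name `N`. -/
theorem firstOcc_eq_iff {N i : ℕ} {κ : ℕ → ℕ} {c : ℕ} (hi : i < N) :
    firstOcc N κ (κ i) = firstOcc N κ c ↔ κ i = c := by
  refine ⟨fun h => ?_, fun h => by rw [h]⟩
  have h1 := firstOcc_of_occurs (κ := κ) ⟨i, hi, rfl⟩
  by_cases hc : ∃ i < N, κ i = c
  · rw [← h1.2, h, (firstOcc_of_occurs hc).2]
  · rw [firstOcc_of_not_occurs hc] at h
    omega

/-- The number that represents position `0` in the part of the key universe for color `c`. -/
noncomputable def keyBase (l N : ℕ) (κ : ℕ → ℕ) (c : ℕ) : ℕ :=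
  2 ^ (2 * l) + (firstOcc N κ c + 1) * 2 ^ l

/-- The keys: one for each position, filed under its color, and a sentinel. -/
def IsKey (l N : ℕ) (κ : ℕ → ℕ) (y : ℕ) : Prop :=
  y = 2 ^ (2 * l) ∨ ∃ i < N, y = keyBase l N κ (κ i) + i

noncomputable instance (l N : ℕ) (κ : ℕ → ℕ) : DecidablePred (IsKey l N κ) :=
  Classical.decPred _

theorem keyBase_add_lt {l N : ℕ} {κ : ℕ → ℕ} {c i : ℕ} (hN : N + 2 ≤ 2 ^ l) (hi : i < 2 ^ l) :
    keyBase l N κ c + i < 2 ^ (2 * l + 1) := by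
  have h := firstOcc_le N κ c
  unfold keyBase
  rw [pow_succ, two_mul l, pow_add]
  nlinarith

theorem IsKey.bounds {l N : ℕ} {κ : ℕ → ℕ} {y : ℕ} (hN : N + 2 ≤ 2 ^ l) (h : IsKey l N κ y) :
    2 ^ (2 * l) ≤ y ∧ y < 2 ^ (2 * l + 1) := by
  rcases h with rfl | ⟨i, hi, rfl⟩
  · exact ⟨le_rfl, Nat.pow_lt_pow_right one_lt_two (by omega)⟩
  · exact ⟨by unfold keyBase; omega, keyBase_add_lt hN (by omega)⟩

/-- Each color name owns a block of `2 ^ l` numbers, and the `+ 1` in `keyBase` keeps the sentinel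
out of all of them. Name and position are recovered as quotient and remainder. -/
theorem isKey_keyBase_add {l N : ℕ} {κ : ℕ → ℕ} {c i : ℕ} (hN : N + 2 ≤ 2 ^ l) (hi : i < 2 ^ l) :
    IsKey l N κ (keyBase l N κ c + i) ↔ i < N ∧ κ i = c := by
  constructor
  · rintro (h | ⟨j, hj, h⟩)
    · unfold keyBase at h
      have : 0 < (firstOcc N κ c + 1) * 2 ^ l := by positivity
      omega
    · unfold keyBase at h
      have h' : i + 2 ^ l * (firstOcc N κ c + 1) = j + 2 ^ l * (firstOcc N κ (κ j) + 1) := by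
        linarith
      have e1 := congrArg (· % 2 ^ l) h'
      have e2 := congrArg (· / 2 ^ l) h'
      have hjl : j < 2 ^ l := by omega
      simp only [Nat.add_mul_mod_self_left, Nat.mod_eq_of_lt hi, Nat.mod_eq_of_lt hjl] at e1
      simp only [Nat.add_mul_div_left _ _ (Nat.two_pow_pos l), Nat.div_eq_of_lt hi,
        Nat.div_eq_of_lt hjl] at e2
      subst e1
      exact ⟨hj, (firstOcc_eq_iff hj).mp (by omega)⟩
  · rintro ⟨hiN, rfl⟩
    exact Or.inr ⟨i, hiN, rfl⟩

theorem count_isKey_le {l N : ℕ} {κ : ℕ → ℕ} (E : ℕ) :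
    Nat.count (IsKey l N κ) E ≤ N + 1 := by
  rw [Nat.count_eq_card_filter_range]
  have : ((Finset.range E).filter (IsKey l N κ)) ⊆
      insert (2 ^ (2 * l)) ((Finset.range N).image fun i => keyBase l N κ (κ i) + i) := by
    intro y hy
    rcases (Finset.mem_filter.mp hy).2 with rfl | ⟨i, hi, rfl⟩
    · simp
    · simp only [Finset.mem_insert, Finset.mem_image, Finset.mem_range]
      exact Or.inr ⟨i, hi, rfl⟩
  refine (Finset.card_le_card this).trans ((Finset.card_insert_le _ _).trans ?_)
  have := Finset.card_image_le (s := Finset.range N) (f := fun i => keyBase l N κ (κ i) + i)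
  rw [Finset.card_range] at this
  omega

/-- The predecessor of a position among the keys gives the label. -/
theorem lastLabel_eq_of_pred {l N : ℕ} {κ T : ℕ → ℕ} {c s r y : ℕ} (hN : N + 2 ≤ 2 ^ l)
    (hr : r < N) (hy : IsKey l N κ y) (hlt : y < keyBase l N κ c + r)
    (hlast : ∀ z, y < z → z < keyBase l N κ c + r → ¬ IsKey l N κ z) :
    lastLabel κ T c s r = if y < keyBase l N κ c + s then s else T (y % 2 ^ l) := by
  split_ifs with h
  -- The predecessor may be a key of another color, the sentinel, or a position in an earlier walk;
  -- all of these lie below `keyBase l N κ c + s`.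
  · refine lastLabel_of_none fun j hj hjr hκ => hlast (keyBase l N κ c + j) (by omega) (by omega) ?_
    exact (isKey_keyBase_add hN (by omega)).mpr ⟨by omega, hκ⟩
  · obtain ⟨i, rfl⟩ := Nat.exists_eq_add_of_le (show keyBase l N κ c ≤ y by omega)
    have hi : i < 2 ^ l := by omega
    have hmod : (keyBase l N κ c + i) % 2 ^ l = i := by
      unfold keyBase
      rw [two_mul, pow_add, ← add_mul, add_comm, Nat.add_mul_mod_self_right, Nat.mod_eq_of_lt hi]
    rw [hmod]
    rw [isKey_keyBase_add hN hi] at hy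
    refine lastLabel_of_last (by omega) (by omega) hy.2 fun j hj hjr hκ =>
      hlast (keyBase l N κ c + j) (by omega) (by omega) ?_
    exact (isKey_keyBase_add hN (by omega)).mpr ⟨by omega, hκ⟩

end ColorFault

/-! ### Word arithmetic, memory layout and binary search -/

namespace WordRAM

namespace Expr

variable {w : ℕ} {mem : List ℕ} {σ : ℕ → ℕ} {a b : Expr} {x y : ℕ}

theorem eval_var (x : ℕ) : (var x).eval w mem σ = σ x := rfl

theorem eval_const {k : ℕ} (hk : k < 2 ^ w) : (const k).eval w mem σ = k := Nat.mod_eq_of_lt hk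

theorem eval_add (ha : a.eval w mem σ = x) (hb : b.eval w mem σ = y) (h : x + y < 2 ^ w) :
    (bin .add a b).eval w mem σ = x + y := by
  simp [eval, BinOp.eval, ha, hb, Nat.mod_eq_of_lt h]

theorem eval_mul (ha : a.eval w mem σ = x) (hb : b.eval w mem σ = y) (h : x * y < 2 ^ w) :
    (bin .mul a b).eval w mem σ = x * y := by
  simp [eval, BinOp.eval, ha, hb, Nat.mod_eq_of_lt h]

theorem eval_div (ha : a.eval w mem σ = x) (hb : b.eval w mem σ = y) (h : x < 2 ^ w) :
    (bin .div a b).eval w mem σ = x / y := by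
  simp [eval, BinOp.eval, ha, hb, Nat.mod_eq_of_lt ((Nat.div_le_self x y).trans_lt h)]

theorem eval_mod (ha : a.eval w mem σ = x) (hb : b.eval w mem σ = y) (h : x < 2 ^ w) :
    (bin .mod a b).eval w mem σ = x % y := by
  simp [eval, BinOp.eval, ha, hb, Nat.mod_eq_of_lt ((Nat.mod_le x y).trans_lt h)]

theorem eval_shr (ha : a.eval w mem σ = x) (hb : b.eval w mem σ = y) (h : x < 2 ^ w) :
    (bin .shr a b).eval w mem σ = x / 2 ^ y := by
  simp [eval, BinOp.eval, ha, hb, Nat.shiftRight_eq_div_pow,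
    Nat.mod_eq_of_lt ((Nat.div_le_self x (2 ^ y)).trans_lt h)]

/-- The truth value of `a = b`. -/
def eq (a b : Expr) : Expr := bin .div (const 1) (bin .add (const 1) (bin .xor a b))

/-- The truth value of `a = 0`, which negates truth values. -/
def isZero (a : Expr) : Expr := eq a (const 0)

/-- The truth value of `a < b`. -/
def lt (a b : Expr) : Expr := isZero (isZero (bin .div b (bin .add a (const 1))))

theorem eval_eq (hw : 1 ≤ w) (ha : a.eval w mem σ = x) (hb : b.eval w mem σ = y)
    (hx : x < 2 ^ w) (hy : y < 2 ^ w) :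
    (eq a b).eval w mem σ = if x = y then 1 else 0 := by
  have h1 : 1 < 2 ^ w := Nat.one_lt_two_pow (by omega)
  have hz : x ^^^ y < 2 ^ w := Nat.xor_lt_two_pow hx hy
  simp only [eq, eval, BinOp.eval, ha, hb, Nat.mod_eq_of_lt h1, Nat.mod_eq_of_lt hz]
  split_ifs with hxy
  · subst hxy
    simp [Nat.mod_eq_of_lt h1]
  · have hz0 : x ^^^ y ≠ 0 := by rwa [ne_eq, Nat.xor_eq_zero_iff]
    generalize x ^^^ y = z at hz hz0
    have : 1 / ((1 + z) % 2 ^ w) = 0 := by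
      rcases Nat.lt_or_ge (1 + z) (2 ^ w) with h | h
      · rw [Nat.mod_eq_of_lt h]; exact Nat.div_eq_of_lt (by omega)
      -- If `z` is the all-ones word, the sum wraps around to `0`, and `1 / 0 = 0` is still the
      -- right answer.
      · rw [show 1 + z = 2 ^ w by omega]; simp
    rw [this]; simp

theorem eval_isZero (hw : 1 ≤ w) (ha : a.eval w mem σ = x) (hx : x < 2 ^ w) :
    (isZero a).eval w mem σ = if x = 0 then 1 else 0 :=
  eval_eq hw ha (eval_const (by positivity)) hx (by positivity)

theorem eval_lt (hw : 1 ≤ w) (ha : a.eval w mem σ = x) (hb : b.eval w mem σ = y)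
    (hx : x + 1 < 2 ^ w) (hy : y < 2 ^ w) :
    (lt a b).eval w mem σ = if x < y then 1 else 0 := by
  have h1 : 1 < 2 ^ w := Nat.one_lt_two_pow (by omega)
  have h := eval_div hb (eval_add ha (eval_const h1) hx) hy
  have h' := eval_isZero hw h ((Nat.div_le_self _ _).trans_lt hy)
  rw [lt, eval_isZero hw h' (by split_ifs <;> omega)]
  have : y / (x + 1) = 0 ↔ y < x + 1 := by rw [Nat.div_eq_zero_iff]; omega
  by_cases hxy : x < y
  · have h0 : y / (x + 1) ≠ 0 := fun h0 => by have := this.mp h0; omega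
    simp only [hxy, h0, if_true, if_false]
  · have h0 : y / (x + 1) = 0 := this.mpr (by omega)
    simp only [hxy, h0, if_true, if_false, one_ne_zero]

/-- Entry `i` of table `f` in a memory where `16` tables are interleaved. -/
def entry (f i : Expr) : Expr := load (bin .add (bin .mul i (const 16)) f)

end Expr

/-- The memory content in which the entries below `S` of `16` tables are interleaved. -/
def interleave (w S : ℕ) (tab : ℕ → ℕ → ℕ) : List ℕ :=
  (List.range (16 * S)).map fun i => tab (i % 16) (i / 16) % 2 ^ w

theorem length_interleave (w S : ℕ) (tab : ℕ → ℕ → ℕ) : (interleave w S tab).length = 16 * S := by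
  simp [interleave]

theorem lt_of_mem_interleave {w S : ℕ} {tab : ℕ → ℕ → ℕ} {x : ℕ} (hx : x ∈ interleave w S tab) :
    x < 2 ^ w := by
  simp only [interleave, List.mem_map] at hx
  obtain ⟨i, -, rfl⟩ := hx
  exact Nat.mod_lt _ (by positivity)

/-- Interleaving gives the address `i * 16 + f`, without base addresses that depend on `n`; this
lets one program serve all oracles. -/
theorem Expr.eval_entry {w S : ℕ} {tab : ℕ → ℕ → ℕ} {σ : ℕ → ℕ} {a b : Expr} {f i : ℕ}
    (ha : a.eval w (interleave w S tab) σ = f) (hb : b.eval w (interleave w S tab) σ = i)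
    (hf : f < 16) (hi : i < S) (hw : 16 * S + 16 < 2 ^ w) (h : tab f i < 2 ^ w) :
    (entry a b).eval w (interleave w S tab) σ = tab f i := by
  have h1 := eval_add (eval_mul hb (eval_const (k := 16) (by omega)) (by omega)) ha (by omega)
  rw [entry, eval, h1, interleave, List.getD_eq_getElem _ _ (by simp; omega)]
  simp only [List.getElem_map, List.getElem_range]
  rw [show (i * 16 + f) % 16 = f by omega, show (i * 16 + f) / 16 = i by omega,
    Nat.mod_eq_of_lt h]

namespace Cmd

/-- An upper bound for the number of steps, if every loop body is executed once. -/
def weight : Cmd → ℕ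
  | assign _ e => e.size + 1
  | seq c d => weight c + weight d
  | loop c _ => weight c + 2

/-- The command `c` takes register contents `σ` to `σ'` within `m` times its weight. -/
def Runs (w : ℕ) (mem : List ℕ) (m : ℕ) (c : Cmd) (σ σ' : ℕ → ℕ) : Prop :=
  ∃ k ≤ m * c.weight, Exec w mem c σ σ' k

theorem Runs.assign {w : ℕ} {mem : List ℕ} {m : ℕ} (hm : 1 ≤ m) (r : ℕ) {e : Expr} {σ : ℕ → ℕ}
    {x : ℕ} (h : e.eval w mem σ = x) :
    Runs w mem m (Cmd.assign r e) σ (Function.update σ r x) :=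
  ⟨_, Nat.le_mul_of_pos_left _ hm, h ▸ Exec.assign r e σ⟩

theorem Runs.seq {w : ℕ} {mem : List ℕ} {m : ℕ} {c d : Cmd} {σ σ' σ'' : ℕ → ℕ}
    (h : Runs w mem m c σ σ') (h' : Runs w mem m d σ' σ'') : Runs w mem m (seq c d) σ σ'' := by
  obtain ⟨k, hk, h⟩ := h
  obtain ⟨l, hl, h'⟩ := h'
  exact ⟨k + l, by rw [weight, mul_add]; omega, Exec.seq h h'⟩

/-- Binary search: `r` grows by decreasing powers of two `d`, as long as the test `e` says so. -/
def search (r d : ℕ) (e : Expr) : Cmd :=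
  loop (seq (assign r (.bin .add (.var r) (.bin .mul (.var d) e)))
    (assign d (.bin .div (.var d) (.const 2)))) d

theorem Exec.of_eq {w : ℕ} {mem : List ℕ} {c : Cmd} {σ σ' : ℕ → ℕ} {k l : ℕ}
    (h : Exec w mem c σ σ' k) (hk : k = l) : Exec w mem c σ σ' l := hk ▸ h

/-- The invariant is `r ≤ c < r + 2 * d`. Multiplying `d` by the truth value of the test replaces a
branch, and halving `d = 1` gives `0`, which ends the loop. -/
theorem runs_search {w : ℕ} {mem : List ℕ} {r d c : ℕ} {e : Expr} (hrd : r ≠ d) (hw : 2 ≤ w)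
    (hc : c < 2 ^ w) (j : ℕ) (σ : ℕ → ℕ) (hd : σ d = 2 ^ j) (hj : 2 ^ j < 2 ^ w) (hr : σ r ≤ c)
    (hcr : c < σ r + 2 * 2 ^ j)
    (he : ∀ τ : ℕ → ℕ, (∀ x, x ≠ r → x ≠ d → τ x = σ x) → τ r ≤ c → τ d ≤ 2 ^ j → 0 < τ d →
      e.eval w mem τ = if τ r + τ d ≤ c then 1 else 0) :
    ∃ τ, Runs w mem (j + 1) (search r d e) σ τ ∧ τ r = c ∧ ∀ x, x ≠ r → x ≠ d →
      τ x = σ x := by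
  suffices h : ∃ τ, Exec w mem (search r d e) σ τ ((j + 1) * (e.size + 11)) ∧ τ r = c ∧
      ∀ x, x ≠ r → x ≠ d → τ x = σ x by
    obtain ⟨τ, h, h'⟩ := h
    exact ⟨τ, ⟨_, Nat.mul_le_mul_left _ (by simp only [search, weight, Expr.size]; omega), h⟩, h'⟩
  have h2 : 2 < 2 ^ w := (show 2 < 2 ^ 2 by norm_num).trans_le (Nat.pow_le_pow_right two_pos hw)
  have body : ∀ {j : ℕ} {σ : ℕ → ℕ}, σ d = 2 ^ j → 2 ^ j < 2 ^ w → σ r ≤ c →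
      c < σ r + 2 * 2 ^ j → e.eval w mem σ = (if σ r + σ d ≤ c then 1 else 0) →
      ∃ τ, Exec w mem (seq (assign r (.bin .add (.var r) (.bin .mul (.var d) e)))
          (assign d (.bin .div (.var d) (.const 2)))) σ τ (e.size + 9) ∧
        τ d = 2 ^ j / 2 ∧ τ r ≤ c ∧ c < τ r + 2 ^ j ∧ ∀ x, x ≠ r → x ≠ d → τ x = σ x := by
    intro j σ hd hj hr hcr he
    rw [hd] at he
    have hmul : σ d * (if σ r + 2 ^ j ≤ c then 1 else 0) < 2 ^ w := by
      rw [hd]; split_ifs <;> omega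
    have hadd : σ r + σ d * (if σ r + 2 ^ j ≤ c then 1 else 0) < 2 ^ w := by
      rw [hd]; split_ifs <;> omega
    have h1 := Exec.assign (w := w) (mem := mem) r (.bin .add (.var r) (.bin .mul (.var d) e)) σ
    rw [Expr.eval_add (a := .var r) rfl (Expr.eval_mul (a := .var d) rfl he hmul) hadd] at h1
    have h3 := Exec.assign (w := w) (mem := mem) d (.bin .div (.var d) (.const 2))
      (Function.update σ r (σ r + σ d * (if σ r + 2 ^ j ≤ c then 1 else 0)))
    rw [Expr.eval_div (x := 2 ^ j) (y := 2) (by simp [Expr.eval, hrd.symm, hd])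
      (Expr.eval_const h2) hj] at h3
    refine ⟨_, (Exec.seq h1 h3).of_eq (by simp only [Expr.size]; omega), ?_, ?_, ?_,
      fun x hxr hxd => ?_⟩
    · rw [Function.update_self]
    · rw [Function.update_of_ne hrd, Function.update_self, hd]
      split_ifs <;> omega
    · rw [Function.update_of_ne hrd, Function.update_self, hd]
      split_ifs <;> omega
    · rw [Function.update_of_ne hxd, Function.update_of_ne hxr]
  induction j generalizing σ with
  | zero =>
    obtain ⟨τ, hτ, hτd, hτr, hτr', hτx⟩ := body hd hj hr hcr
      (he σ (fun _ _ _ => rfl) hr hd.le (by rw [hd]; positivity))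
    exact ⟨τ, (Exec.loop_stop hτ (by rw [hτd]; rfl)).of_eq (by ring), by omega, hτx⟩
  | succ j ih =>
    obtain ⟨τ, hτ, hτd, hτr, hτr', hτx⟩ := body hd hj hr hcr
      (he σ (fun _ _ _ => rfl) hr hd.le (by rw [hd]; positivity))
    have hpow : 2 ^ (j + 1) / 2 = 2 ^ j := by rw [pow_succ]; omega
    rw [hpow] at hτd
    have hle : 2 ^ j ≤ 2 ^ (j + 1) := Nat.pow_le_pow_right two_pos (by omega)
    obtain ⟨ρ, hρ, hρr, hρx⟩ := ih τ hτd (by omega) hτr (by rw [pow_succ] at hτr'; omega)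
      fun ρ hρ hρr hρd hρ0 => he ρ (fun x h h' => (hρ x h h').trans (hτx x h h')) hρr
        (hρd.trans hle) hρ0
    exact ⟨ρ, (Exec.loop_step hτ (by rw [hτd]; positivity) hρ).of_eq (by ring), hρr,
      fun x h h' => (hρx x h h').trans (hτx x h h')⟩

end Cmd

end WordRAM

/-! ### The query program and the contents of the memory -/

namespace ColorFault

open WordRAM WordRAM.Expr

/-- The entry `k` of the header of the memory. -/
def headerExpr (k : ℕ) : Expr := entry (const 0) (const k)

/-- The hash value of `x` for range `s` and multiplier `a`. -/
def hashExpr (s a x : Expr) : Expr := .bin .mod (.bin .mod (.bin .mul a x) (headerExpr 0)) s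

/-- The first-level hash value of `x`. -/
def bucketExpr (x : Expr) : Expr := hashExpr (headerExpr 2) (headerExpr 1) x

/-- The place of `x` in the dictionary. -/
def placeExpr (x : Expr) : Expr :=
  .bin .add (entry (const 6) (bucketExpr x))
    (hashExpr (entry (const 5) (bucketExpr x)) (entry (const 4) (bucketExpr x)) x)

/-- Whether `x` is in the dictionary. -/
def memberExpr (x : Expr) : Expr := Expr.eq (entry (const 7) (placeExpr x)) x

/-- The dictionary key for the prefix of register `4` without the last `t` bits. -/
def prefixExpr (t : Expr) : Expr :=
  .bin .add (headerExpr 3) (.bin .shr (.bin .mul (.var 4) (const 2)) t)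

/-- Put the base of the key range for the color in register `2` into register `3`. -/
def baseCmd : Cmd :=
  .assign 3 (.bin .add (.bin .mul (memberExpr (.var 2)) (entry (const 8) (placeExpr (.var 2))))
    (.bin .mul (isZero (memberExpr (.var 2))) (headerExpr 5)))

/-- Put the label of the vertex in register `v` into register `out`. -/
def labelCmd (v out : ℕ) : Cmd :=
  .seq (.assign 4 (.bin .add (.var 3) (entry (const 1) (.var v)))) <|
  .seq (.assign 5 (const 0)) <|
  .seq (.assign 6 (headerExpr 4)) <|
  .seq (.search 5 6 (isZero (memberExpr (prefixExpr (.bin .add (.var 5) (.var 6)))))) <|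
  .seq (.assign 7 (entry (.bin .add (const 8)
      (.bin .mod (.bin .shr (.bin .mul (.var 4) (const 2)) (.var 5)) (const 2)))
    (placeExpr (prefixExpr (.bin .add (.var 5) (const 1)))))) <|
  .seq (.assign 6 (headerExpr 4)) <|
  .seq (.search 7 6 (lt (entry (const 10) (.bin .add (.var 7) (.var 6))) (.var 4))) <|
  .seq (.assign 10 (lt (entry (const 10) (.var 7))
    (.bin .add (.var 3) (entry (const 2) (.var v))))) <|
  .assign out (.bin .add (.bin .mul (.var 10) (entry (const 2) (.var v)))
    (.bin .mul (isZero (.var 10)) (entry (const 11) (.var 7))))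

/-- The query algorithm: the vertices in registers `0` and `1` survive the failure of the color in
register `2`, they belong to the same component, and their labels are equal. -/
def queryCmd : Cmd :=
  .seq baseCmd <| .seq (labelCmd 0 8) <| .seq (labelCmd 1 9) <|
  .assign 0 (.bin .mul
    (.bin .mul (isZero (Expr.eq (entry (const 3) (.var 0)) (.var 2)))
      (isZero (Expr.eq (entry (const 3) (.var 1)) (.var 2))))
    (.bin .mul (Expr.eq (entry (const 2) (.var 0)) (entry (const 2) (.var 1)))
      (Expr.eq (.var 8) (.var 9))))

/-- The ingredients of an oracle: `n` vertices with positions, start positions of their components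
and colors, a sequence of `N < 2 ^ l` positions with colors `κ` and labels `T`, and a two-level
hash table with modulus `p`, multipliers `a` and `A`, ranges `s` and `S`, and offsets `O`. -/
structure OracleData where
  (n C N l p a s : ℕ)
  (A S O κ T pos start vcol : ℕ → ℕ)

namespace OracleData

variable (D : OracleData)

/-- The sampling distance in the sorted sequence of keys. -/
def gap : ℕ := 2 * D.l + 2

/-- The first step width of the binary searches. -/
def half : ℕ := 2 ^ Nat.log 2 D.gap

/-- The place of `x` in the dictionary. -/
def place (x : ℕ) : ℕ := slot D.p D.s D.a D.A D.S D.O x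

/-- The keys of the dictionary: the colors that occur, and the prefixes of the samples. -/
noncomputable def keys : Finset ℕ :=
  (((Finset.range D.N).image D.κ).filter (· ≤ D.C)) ∪
    (prefixes (IsKey D.l D.N D.κ) D.gap (2 * D.l)).image (D.C + 1 + ·)

open Classical in
/-- The key stored at a place of the dictionary, or the number `p`, which is not a key. -/
noncomputable def stored (j : ℕ) : ℕ :=
  if h : ∃ x ∈ D.keys, D.place x = j then h.choose else D.p

/-- The start of the stretch for a prefix `y` and the next bit `b`. -/
noncomputable def node (y b : ℕ) : ℕ :=
  stretch (IsKey D.l D.N D.κ) D.gap ((y + b) * 2 ^ (2 * D.l - Nat.log 2 y))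

/-- The values stored in the dictionary. -/
noncomputable def value (b x : ℕ) : ℕ :=
  if x ≤ D.C then keyBase D.l D.N D.κ x else D.node (x - (D.C + 1)) b

/-- The sorted array of keys. -/
noncomputable def array (i : ℕ) : ℕ := sortedArray (IsKey D.l D.N D.κ) (2 ^ (2 * D.l + 1)) i

/-- The header of the memory. -/
def header : ℕ → ℕ
  | 0 => D.p
  | 1 => D.a
  | 2 => D.s
  | 3 => D.C + 1
  | 4 => D.half
  | _ => 2 ^ (2 * D.l) + (D.N + 1) * 2 ^ D.l

/-- The tables that make up the memory. -/
noncomputable def table : ℕ → ℕ → ℕ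
  | 0 => D.header
  | 1 => D.pos
  | 2 => D.start
  | 3 => D.vcol
  | 4 => D.A
  | 5 => D.S
  | 6 => D.O
  | 7 => D.stored
  | 8 => fun j => D.value 0 (D.stored j)
  | 9 => fun j => D.value 1 (D.stored j)
  | 10 => D.array
  | 11 => fun i => D.T (D.array i % 2 ^ D.l)
  | _ => fun _ => 0

/-- The sizes fit together, for words of `w` bits, numbers below `R`, and tables with `S₀`
entries. -/
structure Good (w R S₀ : ℕ) : Prop where
  sq : 4 * (R * R) ≤ 2 ^ w
  size : 16 * S₀ + 16 ≤ R
  header : 6 ≤ S₀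
  N_lt : D.N + 2 ≤ 2 ^ D.l
  univ : D.C + 1 + 2 ^ (2 * D.l + 1) < D.p
  p_lt : D.p < R
  s_pos : 0 < D.s
  s_le : D.s ≤ S₀
  a_lt : D.a < D.p
  A_lt : ∀ i, D.A i < D.p
  S_lt : ∀ i < D.s, D.S i < R
  O_lt : ∀ i < D.s, D.O i < R
  place_lt : ∀ x, D.place x < S₀
  injOn : Set.InjOn D.place D.keys
  array : D.N + 1 + D.half < S₀
  vertices : D.n ≤ S₀
  pos_lt : ∀ u < D.n, D.pos u < D.N
  start_le : ∀ u < D.n, D.start u ≤ D.N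
  vcol_le : ∀ u < D.n, D.vcol u ≤ D.C
  T_lt : ∀ i, D.T i < R

variable {D} {w R S₀ : ℕ}

theorem stored_place (h : D.Good w R S₀) {x : ℕ} (hx : x ∈ D.keys) :
    D.stored (D.place x) = x := by
  have hex : ∃ y ∈ D.keys, D.place y = D.place x := ⟨x, hx, rfl⟩
  unfold stored
  rw [dif_pos hex]
  exact h.injOn hex.choose_spec.1 hx hex.choose_spec.2

/-- Any number can be hashed, so membership is decided by comparison with the key found at the
place. Empty places hold `D.p`, which differs from every `x` looked up. -/
theorem stored_place_eq_iff (h : D.Good w R S₀) {x : ℕ} (hx : x < D.p) :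
    D.stored (D.place x) = x ↔ x ∈ D.keys := by
  refine ⟨fun heq => ?_, stored_place h⟩
  by_cases hex : ∃ y ∈ D.keys, D.place y = D.place x
  · unfold stored at heq
    rw [dif_pos hex] at heq
    exact heq ▸ hex.choose_spec.1
  · unfold stored at heq
    rw [dif_neg hex] at heq
    omega

theorem lt_p_of_mem_keys (hp : D.C + 1 + 2 ^ (2 * D.l + 1) < D.p) {x : ℕ} (hx : x ∈ D.keys) :
    x < D.p := by
  simp only [keys, Finset.mem_union, Finset.mem_filter, Finset.mem_image] at hx
  rcases hx with ⟨-, hx⟩ | ⟨y, hy, rfl⟩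
  · exact lt_of_le_of_lt (by omega) (Nat.lt_of_add_right_lt hp)
  · have := le_of_mem_prefixes hy
    show D.C + 1 + y < D.p
    omega

theorem color_mem_keys {c : ℕ} (hc : c ≤ D.C) : c ∈ D.keys ↔ ∃ i < D.N, D.κ i = c := by
  simp only [keys, Finset.mem_union, Finset.mem_filter, Finset.mem_image, Finset.mem_range]
  constructor
  · rintro (⟨h, -⟩ | ⟨y, hy, rfl⟩)
    · exact h
    · omega
  · exact fun h => Or.inl ⟨h, hc⟩

theorem prefix_mem_keys {y : ℕ} :
    D.C + 1 + y ∈ D.keys ↔ y ∈ prefixes (IsKey D.l D.N D.κ) D.gap (2 * D.l) := by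
  simp only [keys, Finset.mem_union, Finset.mem_filter, Finset.mem_image, Finset.mem_range]
  constructor
  · rintro (⟨-, h⟩ | ⟨z, hz, h⟩)
    · omega
    · rwa [← Nat.add_left_cancel h]
  · exact fun h => Or.inr ⟨y, h, rfl⟩

theorem node_le (y b : ℕ) : D.node y b ≤ D.N + 1 := (stretch_le _ _).trans (count_isKey_le _)

theorem keyBase_lt (h : D.Good w R S₀) (c : ℕ) : keyBase D.l D.N D.κ c < 2 ^ (2 * D.l + 1) :=
  keyBase_add_lt (i := 0) h.N_lt (by positivity)

theorem value_lt (h : D.Good w R S₀) (b x : ℕ) : D.value b x < R := by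
  have := keyBase_lt h x
  have := h.univ
  have := h.p_lt
  have := h.array
  have := h.size
  have := D.node_le (x - (D.C + 1)) b
  unfold value
  split_ifs <;> omega

theorem array_le (i : ℕ) : D.array i ≤ 2 ^ (2 * D.l + 1) := by
  rcases Nat.eq_zero_or_pos i with rfl | hi
  · unfold array sortedArray
    rw [if_pos (Nat.zero_le _)]
    rcases Nat.eq_zero_or_pos (Nat.count (IsKey D.l D.N D.κ) (2 ^ (2 * D.l + 1))) with h0 | h0
    -- At index `0` truncated subtraction gives the first key, which exists thanks to the sentinel.
    · have : IsKey D.l D.N D.κ (2 ^ (2 * D.l)) := Or.inl rfl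
      have h := Nat.count_strict_mono this (Nat.pow_lt_pow_right one_lt_two (show 2 * D.l < 2 * D.l + 1 by omega))
      omega
    · exact (nth_of_lt_count h0).1.le
  · exact sortedArray_le hi

theorem stored_lt (h : D.Good w R S₀) (j : ℕ) : D.stored j < R := by
  unfold stored
  split_ifs with hex
  · exact (lt_p_of_mem_keys h.univ hex.choose_spec.1).trans h.p_lt
  · exact h.p_lt

/-- The memory content of the oracle. -/
noncomputable def mem (D : OracleData) (w S₀ : ℕ) : List ℕ := interleave w S₀ D.table

section Eval

variable {σ : ℕ → ℕ} {e : Expr} {x : ℕ}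

theorem Good.R_lt (h : D.Good w R S₀) : 4 * R < 2 ^ w := by
  have h1 := h.size
  have h2 := h.sq
  nlinarith

theorem Good.two_le_w (h : D.Good w R S₀) : 2 ≤ w := by
  have h1 := h.R_lt
  have h2 := h.size
  by_contra! hw
  have : 2 ^ w ≤ 2 ^ 1 := Nat.pow_le_pow_right two_pos (by omega)
  omega

theorem Good.mul_lt (h : D.Good w R S₀) {x y : ℕ} (hx : x < R) (hy : y < R) : x * y < 2 ^ w := by
  have h2 := h.sq
  nlinarith

theorem eval_entry_const (h : D.Good w R S₀) {f i : ℕ} (hf : f < 16) (he : e.eval w (D.mem w S₀) σ = i) (hi : i < S₀)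
    (hR : D.table f i < R) :
    (entry (const f) e).eval w (D.mem w S₀) σ = D.table f i := by
  have h1 := h.size
  have h2 := h.R_lt
  exact Expr.eval_entry (eval_const (by omega)) he hf hi (by omega) (by omega)

theorem header_lt (h : D.Good w R S₀) (k : ℕ) : D.header k < R := by
  have := h.univ
  have := h.p_lt
  have := h.a_lt
  have := h.s_le
  have := h.size
  have := h.array
  have h1 : 2 ^ (2 * D.l) + (D.N + 1) * 2 ^ D.l < 2 ^ (2 * D.l + 1) := by
    have := h.N_lt
    rw [pow_succ, two_mul D.l, pow_add]
    nlinarith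
  unfold header
  split <;> omega

theorem eval_header (h : D.Good w R S₀) {k : ℕ} (hk : k < 6) :
    (headerExpr k).eval w (D.mem w S₀) σ = D.header k := by
  have h1 := h.header
  have h2 := h.R_lt
  have h3 := h.size
  exact eval_entry_const h (f := 0) (by omega) (eval_const (by omega)) (by omega) (header_lt h k)

theorem eval_hash (h : D.Good w R S₀) {es ea : Expr} {s a : ℕ} (hs : es.eval w (D.mem w S₀) σ = s)
    (ha : ea.eval w (D.mem w S₀) σ = a) (he : e.eval w (D.mem w S₀) σ = x) (haR : a < R)
    (hx : x < R) :
    (hashExpr es ea e).eval w (D.mem w S₀) σ = hash D.p s a x := by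
  have h1 := h.mul_lt haR hx
  exact eval_mod (eval_mod (eval_mul ha he h1) (eval_header h (k := 0) (by omega)) h1) hs
    ((Nat.mod_le _ _).trans_lt h1)

theorem eval_bucket (h : D.Good w R S₀) (he : e.eval w (D.mem w S₀) σ = x) (hx : x < R) :
    (bucketExpr e).eval w (D.mem w S₀) σ = hash D.p D.s D.a x :=
  eval_hash h (eval_header h (k := 2) (by omega)) (eval_header h (k := 1) (by omega)) he
    (h.a_lt.trans h.p_lt) hx

theorem eval_place (h : D.Good w R S₀) (he : e.eval w (D.mem w S₀) σ = x) (hx : x < R) :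
    (placeExpr e).eval w (D.mem w S₀) σ = D.place x := by
  have hb := eval_bucket h he hx
  have hlt : hash D.p D.s D.a x < D.s := Nat.mod_lt _ h.s_pos
  have hlt' := hlt.trans_le h.s_le
  have hA := (h.A_lt (hash D.p D.s D.a x)).trans h.p_lt
  refine eval_add (eval_entry_const h (f := 6) (by omega) hb hlt' (h.O_lt _ hlt))
    (eval_hash h (eval_entry_const h (f := 5) (by omega) hb hlt' (h.S_lt _ hlt))
      (eval_entry_const h (f := 4) (by omega) hb hlt' hA) he hA hx) ?_
  have h1 := h.place_lt x
  have h2 := h.size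
  have h3 := h.R_lt
  show D.place x < 2 ^ w
  omega

theorem eval_member (h : D.Good w R S₀) (he : e.eval w (D.mem w S₀) σ = x) (hx : x < D.p) :
    (memberExpr e).eval w (D.mem w S₀) σ = if x ∈ D.keys then 1 else 0 := by
  have h2 := h.R_lt
  have h3 := h.p_lt
  have h4 := stored_lt h (D.place x)
  have hw := h.two_le_w
  have := eval_eq (by omega) (eval_entry_const h (f := 7) (by omega) (eval_place h he (hx.trans h3))
    (h.place_lt x) h4) he (by simp only [table]; omega) (by omega)
  rw [memberExpr, this]
  simp only [table, stored_place_eq_iff h hx]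

end Eval

end OracleData

end ColorFault

/-! ### Correctness of the query program -/

namespace ColorFault

open WordRAM WordRAM.Expr

namespace OracleData

variable {D : OracleData} {w R S₀ : ℕ}

/-- The dictionary cannot list the colors that do not occur, as there may be far more than n; a
single header word serves them all. -/
theorem keyBase_eq_header {c : ℕ} (hc : ¬ ∃ i < D.N, D.κ i = c) :
    keyBase D.l D.N D.κ c = D.header 5 := by
  unfold keyBase header
  rw [firstOcc_of_not_occurs hc]
  rfl

theorem runs_baseCmd (h : D.Good w R S₀) {σ : ℕ → ℕ} {m : ℕ} (hm : 1 ≤ m) (hc : σ 2 ≤ D.C) :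
    Cmd.Runs w (D.mem w S₀) m baseCmd σ
      (Function.update σ 3 (keyBase D.l D.N D.κ (σ 2))) := by
  have h1 := h.univ
  have h2 := h.p_lt
  have h3 := h.R_lt
  have hw := h.two_le_w
  have hpow := Nat.two_pow_pos (2 * D.l)
  have hp : σ 2 < D.p := by omega
  have he : (Expr.var 2).eval w (D.mem w S₀) σ = σ 2 := rfl
  have hmem := eval_member h he hp
  have hval := eval_entry_const h (f := 8) (by omega) (eval_place h he (hp.trans h2))
    (h.place_lt _) (value_lt h 0 _)
  have hvlt := value_lt h 0 (D.stored (D.place (σ 2)))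
  have hhlt := header_lt h 5
  refine Cmd.Runs.assign hm 3 ?_
  have h0 := eval_isZero (by omega) hmem (by split_ifs <;> omega)
  have hhd := eval_header h (k := 5) (σ := σ) (by omega)
  simp only [color_mem_keys hc] at hmem
  by_cases hocc : ∃ i < D.N, D.κ i = σ 2
  · have hk := (color_mem_keys hc).mpr hocc
    have hv : D.table 8 (D.place (σ 2)) = keyBase D.l D.N D.κ (σ 2) := by
      simp only [table, stored_place h hk, value, if_pos hc]
    rw [if_pos hocc] at hmem
    rw [if_pos hk] at h0
    rw [hv] at hval
    have hlt := keyBase_lt h (σ 2)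
    have h4 := eval_add (eval_mul hmem hval (by omega)) (eval_mul h0 hhd (by simp))
      (by simp; omega)
    simpa using h4
  · have hk := (color_mem_keys hc).not.mpr hocc
    rw [if_neg hocc] at hmem
    rw [if_neg hk] at h0
    have h4 := eval_add (eval_mul hmem hval (by omega)) (eval_mul h0 hhd (by simp; omega))
      (by simp; omega)
    rw [keyBase_eq_header hocc]
    simpa using h4

/-- Doubling before the shift gives a shift by `t - 1` without a subtraction. The second part makes
the result a legitimate argument of a dictionary lookup. -/
theorem eval_prefix (h : D.Good w R S₀) {σ : ℕ → ℕ} {e : Expr} {t : ℕ}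
    (hX : σ 4 < 2 ^ (2 * D.l + 1)) (he : e.eval w (D.mem w S₀) σ = t) (ht : 1 ≤ t) :
    (prefixExpr e).eval w (D.mem w S₀) σ = D.C + 1 + σ 4 / 2 ^ (t - 1) ∧
      D.C + 1 + σ 4 / 2 ^ (t - 1) < D.p := by
  have h1 := h.univ
  have h2 := h.p_lt
  have h3 := h.R_lt
  have h5 := h.size
  have hdiv : σ 4 * 2 / 2 ^ t = σ 4 / 2 ^ (t - 1) := by
    obtain ⟨t, rfl⟩ := Nat.exists_eq_add_of_le' ht
    rw [Nat.add_sub_cancel, pow_succ, Nat.mul_div_mul_right _ _ two_pos]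
  have hle := Nat.div_le_self (σ 4) (2 ^ (t - 1))
  have hmul := eval_mul (w := w) (mem := D.mem w S₀) (σ := σ) (eval_var 4)
    (eval_const (k := 2) (by omega)) (by omega)
  have h4 := eval_add (eval_header h (k := 3) (by omega))
    (eval_shr hmul he (by omega))
    (show D.C + 1 + _ < _ by rw [hdiv]; omega)
  rw [hdiv] at h4
  exact ⟨h4, by omega⟩

/-- A search with first step width `half` reaches every offset below `2 * half`. This covers the
level, at most `2 * l`, and the rank within a stretch, at most `gap`. -/
theorem half_bounds : D.half ≤ D.gap ∧ D.gap < 2 * D.half := by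
  have hg : D.gap ≠ 0 := by unfold gap; omega
  refine ⟨Nat.pow_log_le_self 2 hg, ?_⟩
  have := Nat.lt_pow_succ_log_self one_lt_two D.gap
  rw [pow_succ] at this
  unfold half
  omega

/-- The key of a vertex with respect to a color. -/
noncomputable def query (D : OracleData) (c v : ℕ) : ℕ := keyBase D.l D.N D.κ c + D.pos v

theorem query_bounds (h : D.Good w R S₀) (c : ℕ) {v : ℕ} (hv : v < D.n) :
    2 ^ (2 * D.l) < D.query c v ∧ D.query c v < 2 ^ (2 * D.l + 1) := by
  have h1 := h.pos_lt v hv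
  have h2 := h.N_lt
  refine ⟨?_, keyBase_add_lt h2 (by omega)⟩
  have : 0 < (firstOcc D.N D.κ c + 1) * 2 ^ D.l := by positivity
  unfold query keyBase
  omega

theorem lastLabel_eq_array (h : D.Good w R S₀) (c : ℕ) {v : ℕ} (hv : v < D.n) :
    lastLabel D.κ D.T c (D.start v) (D.pos v) =
      if D.array (Nat.count (IsKey D.l D.N D.κ) (D.query c v)) < keyBase D.l D.N D.κ c + D.start v
      then D.start v
      else D.T (D.array (Nat.count (IsKey D.l D.N D.κ) (D.query c v)) % 2 ^ D.l) := by
  obtain ⟨hq1, hq2⟩ := query_bounds h c hv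
  have hs : IsKey D.l D.N D.κ (2 ^ (2 * D.l)) := Or.inl rfl
  obtain ⟨ha, hb, hc⟩ := sortedArray_count (p := IsKey D.l D.N D.κ) hq2.le
    ((Nat.zero_le _).trans_lt (Nat.count_strict_mono hs hq1))
  exact lastLabel_eq_of_pred h.N_lt (h.pos_lt v hv) hb ha hc

/-- Only the two searches take more than constant time, each with `Nat.log 2 D.gap + 1` rounds: the
first finds the level of the longest sampled prefix, the second the rank of the predecessor within
the stretch. -/
theorem runs_labelCmd (h : D.Good w R S₀) {σ : ℕ → ℕ} {c v out : ℕ} (hv : v < 2)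
    (hσ : σ v < D.n) (hc : σ 3 = keyBase D.l D.N D.κ c) :
    ∃ τ, Cmd.Runs w (D.mem w S₀) (Nat.log 2 D.gap + 1) (labelCmd v out) σ τ ∧
      τ out = lastLabel D.κ D.T c (D.start (σ v)) (D.pos (σ v)) ∧
      ∀ x, x ≠ out → (x < 4 ∨ x = 8 ∨ x = 9) → τ x = σ x := by
  have huniv := h.univ
  have hpR := h.p_lt
  have hR := h.R_lt
  have hsize := h.size
  have harr := h.array
  have hw := h.two_le_w
  have hNl := h.N_lt
  have hpos := h.pos_lt _ hσ
  have hstart := h.start_le _ hσ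
  have hvS : σ v < S₀ := hσ.trans_le h.vertices
  have hhead := h.header
  obtain ⟨hhalf1, hhalf2⟩ := D.half_bounds
  obtain ⟨hq1, hq2⟩ := query_bounds h c hσ
  have hm : 1 ≤ Nat.log 2 D.gap + 1 := by omega
  set X := D.query c (σ v) with hXdef
  have hX : σ 3 + D.pos (σ v) = X := by rw [hc]; rfl
  obtain ⟨t, htB, htiff, htstretch⟩ := exists_level (p := IsKey D.l D.N D.κ) (q := D.gap)
    (fun s (hs : IsKey D.l D.N D.κ s) => hs.bounds hNl) hq1.le hq2 (Or.inl rfl)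
  set r := Nat.count (IsKey D.l D.N D.κ) X with hr
  have hrN : r ≤ D.N + 1 := count_isKey_le _
  -- the registers after each command
  set σ₁ := Function.update σ 4 X with hσ₁
  have run₁ : Cmd.Runs w (D.mem w S₀) (Nat.log 2 D.gap + 1)
      (.assign 4 (.bin .add (.var 3) (entry (const 1) (.var v)))) σ σ₁ := by
    refine Cmd.Runs.assign hm 4 ?_
    rw [← hX]
    exact eval_add (eval_var _) (eval_entry_const h (f := 1) (by omega) (eval_var _) hvS
      (show D.pos _ < R by omega)) (show _ + D.pos _ < _ by omega)
  set σ₂ := Function.update σ₁ 5 0 with hσ₂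
  have run₂ : Cmd.Runs w (D.mem w S₀) (Nat.log 2 D.gap + 1) (.assign 5 (const 0)) σ₁ σ₂ :=
    Cmd.Runs.assign hm 5 (eval_const (by positivity))
  set σ₃ := Function.update σ₂ 6 D.half with hσ₃
  have run₃ : Cmd.Runs w (D.mem w S₀) (Nat.log 2 D.gap + 1) (.assign 6 (headerExpr 4)) σ₂ σ₃ :=
    Cmd.Runs.assign hm 6 (eval_header h (k := 4) (by omega))
  have e₃ : σ₃ 4 = X ∧ σ₃ 5 = 0 ∧ σ₃ 6 = D.half := by simp [hσ₁, hσ₂, hσ₃]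
  have hgap : D.gap = 2 * D.l + 2 := rfl
  -- The test asks whether the prefix without the last `τ 5 + τ 6 - 1` bits is missing from the
  -- dictionary, which by `htiff` means `τ 5 + τ 6 ≤ t`.
  obtain ⟨σ₄, run₄, e₄, f₄⟩ := Cmd.runs_search (w := w) (mem := D.mem w S₀) (r := 5) (d := 6)
    (c := t) (e := isZero (memberExpr (prefixExpr (.bin .add (.var 5) (.var 6))))) (by omega) hw
    (by omega) (Nat.log 2 D.gap) σ₃ e₃.2.2 (show D.half < 2 ^ w by omega) (by omega)
    (show t < _ + 2 * D.half by omega) (by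
      intro τ hτ hτ5 hτ6 hτ0
      change τ 6 ≤ D.half at hτ6
      have hτ4 : τ 4 = X := (hτ 4 (by omega) (by omega)).trans e₃.1
      have hadd : (Expr.bin .add (.var 5) (.var 6)).eval w (D.mem w S₀) τ = τ 5 + τ 6 :=
        eval_add (eval_var _) (eval_var _) (by omega)
      obtain ⟨hp1, hp2⟩ := eval_prefix h (by omega) hadd (by omega)
      rw [hτ4] at hp1 hp2
      have hmem := eval_member h hp1 hp2
      rw [eval_isZero (by omega) hmem (by split_ifs <;> omega)]
      simp only [prefix_mem_keys, htiff]
      by_cases hle : τ 5 + τ 6 ≤ t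
      · rw [if_pos hle, if_neg (show ¬ t ≤ τ 5 + τ 6 - 1 by omega), if_pos rfl]
      · rw [if_neg hle, if_pos (show t ≤ τ 5 + τ 6 - 1 by omega), if_neg one_ne_zero])
  have g₄ : σ₄ 4 = X := (f₄ 4 (by omega) (by omega)).trans e₃.1
  set r₀ := stretch (IsKey D.l D.N D.κ) D.gap X with hr₀
  set σ₅ := Function.update σ₄ 7 r₀ with hσ₅
  have run₅ : Cmd.Runs w (D.mem w S₀) (Nat.log 2 D.gap + 1)
      (.assign 7 (entry (.bin .add (const 8)
        (.bin .mod (.bin .shr (.bin .mul (.var 4) (const 2)) (.var 5)) (const 2)))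
      (placeExpr (prefixExpr (.bin .add (.var 5) (const 1)))))) σ₄ σ₅ := by
    refine Cmd.Runs.assign hm 7 ?_
    have hmul := eval_mul (w := w) (mem := D.mem w S₀) (σ := σ₄) (eval_var 4)
      (eval_const (k := 2) (by omega)) (by omega)
    have hshr := eval_shr hmul (eval_var 5) (by omega)
    rw [g₄, e₄] at hshr
    have hshrle := Nat.div_le_self (X * 2) (2 ^ t)
    have hbit := eval_mod hshr (eval_const (k := 2) (by omega)) (by omega)
    have hb2 : X * 2 / 2 ^ t % 2 < 2 := Nat.mod_lt _ two_pos
    have hfield := eval_add (eval_const (k := 8) (by omega)) hbit (by omega)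
    have hadd : (Expr.bin .add (.var 5) (const 1)).eval w (D.mem w S₀) σ₄ = t + 1 :=
      eval_add e₄ (eval_const (by omega)) (by omega)
    obtain ⟨hp1, hp2⟩ := eval_prefix h (by omega) hadd (by omega)
    rw [g₄, Nat.add_sub_cancel] at hp1 hp2
    have hplace := eval_place h hp1 (hp2.trans hpR)
    have hmem : D.C + 1 + X / 2 ^ t ∈ D.keys := prefix_mem_keys.mpr ((htiff t).mpr le_rfl)
    have hnode : ∀ b, D.value b (D.C + 1 + X / 2 ^ t) = D.node (X / 2 ^ t) b := by
      intro b
      unfold value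
      rw [if_neg (Nat.not_le.mpr (Nat.lt_of_lt_of_le (Nat.lt_succ_self _) (Nat.le_add_right _ _))),
        Nat.add_sub_cancel_left]
    -- The next bit of `X` selects table `8` or `9`, that is, the left or the right end of the empty
    -- interval below the prefix.
    have htab : D.table (8 + X * 2 / 2 ^ t % 2) (D.place (D.C + 1 + X / 2 ^ t)) = r₀ := by
      have : D.table (8 + X * 2 / 2 ^ t % 2) (D.place (D.C + 1 + X / 2 ^ t)) =
          D.node (X / 2 ^ t) (X * 2 / 2 ^ t % 2) := by
        rcases Nat.mod_two_eq_zero_or_one (X * 2 / 2 ^ t) with hb | hb <;>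
          simp only [hb, table, stored_place h hmem, hnode]
      rw [this, mul_comm X 2]
      exact htstretch
    have hr₀le : r₀ ≤ r := stretch_le _ _
    have := Expr.eval_entry hfield hplace (by omega) (h.place_lt _) (by omega)
      (by rw [htab]; omega)
    rw [htab] at this
    exact this
  set σ₆ := Function.update σ₅ 6 D.half with hσ₆
  have run₆ : Cmd.Runs w (D.mem w S₀) (Nat.log 2 D.gap + 1) (.assign 6 (headerExpr 4)) σ₅ σ₆ :=
    Cmd.Runs.assign hm 6 (eval_header h (k := 4) (by omega))
  have e₆ : σ₆ 4 = X ∧ σ₆ 7 = r₀ ∧ σ₆ 6 = D.half := by simp [hσ₅, hσ₆, g₄]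
  have hr₀r : r ≤ r₀ + D.gap := count_le_stretch_add (by omega) _
  have hr₀le : r₀ ≤ r := stretch_le _ _
  obtain ⟨σ₇, run₇, e₇, f₇⟩ := Cmd.runs_search (w := w) (mem := D.mem w S₀) (r := 7) (d := 6)
    (c := r) (e := lt (entry (const 10) (.bin .add (.var 7) (.var 6))) (.var 4)) (by omega) hw
    (by omega) (Nat.log 2 D.gap) σ₆ e₆.2.2 (show D.half < 2 ^ w by omega) (by omega)
    (show r < _ + 2 * D.half by omega) (by
      intro τ hτ hτ5 hτ6 hτ0
      change τ 6 ≤ D.half at hτ6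
      have hτ4 : τ 4 = X := (hτ 4 (by omega) (by omega)).trans e₆.1
      have hadd : (Expr.bin .add (.var 7) (.var 6)).eval w (D.mem w S₀) τ = τ 7 + τ 6 :=
        eval_add (eval_var _) (eval_var _) (by omega)
      have harrle := D.array_le (τ 7 + τ 6)
      have hent := eval_entry_const h (f := 10) (by omega) hadd (by omega)
        (show D.array _ < R by omega)
      rw [eval_lt (by omega) hent ((eval_var 4).trans hτ4) (show D.array _ + 1 < _ by omega)
        (by omega)]
      have hiff := sortedArray_lt_iff (p := IsKey D.l D.N D.κ) hq2.le
        (show 0 < τ 7 + τ 6 by omega)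
      simp only [table, array, hiff]
      rfl)
  have fin : ∀ x, x < 4 → σ₇ x = σ x := by
    intro x hx
    rw [f₇ x (by omega) (by omega), hσ₆, Function.update_of_ne (by omega), hσ₅,
      Function.update_of_ne (by omega), f₄ x (by omega) (by omega), hσ₃,
      Function.update_of_ne (by omega), hσ₂, Function.update_of_ne (by omega), hσ₁,
      Function.update_of_ne (by omega)]
  have g₇ : σ₇ v = σ v := fin v (by omega)
  have harrle := D.array_le r
  have hstartR : D.start (σ v) < R := by omega
  set b := if D.array r < keyBase D.l D.N D.κ c + D.start (σ v) then 1 else 0 with hb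
  set σ₈ := Function.update σ₇ 10 b with hσ₈
  have hbase := keyBase_lt h c
  have run₈ : Cmd.Runs w (D.mem w S₀) (Nat.log 2 D.gap + 1)
      (.assign 10 (lt (entry (const 10) (.var 7))
        (.bin .add (.var 3) (entry (const 2) (.var v))))) σ₇ σ₈ := by
    refine Cmd.Runs.assign hm 10 ?_
    have h1 := eval_entry_const h (f := 10) (by omega) ((eval_var 7).trans e₇) (by omega)
      (show D.array _ < R by omega)
    have h2 := eval_entry_const h (f := 2) (by omega) ((eval_var v).trans g₇) (by omega)
      (show D.start _ < R by omega)
    have h3 := eval_add ((eval_var 3).trans ((fin 3 (by omega)).trans hc)) h2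
      (show _ + D.start _ < _ by omega)
    exact eval_lt (by omega) h1 h3 (show D.array _ + 1 < _ by omega)
      (show _ + D.start _ < _ by omega)
  have e₈ : σ₈ 10 = b ∧ σ₈ 7 = r ∧ σ₈ v = σ v := by
    refine ⟨by rw [hσ₈, Function.update_self], ?_, ?_⟩
    · rw [hσ₈, Function.update_of_ne (by omega), e₇]
    · rw [hσ₈, Function.update_of_ne (by omega), g₇]
  have run₉ : Cmd.Runs w (D.mem w S₀) (Nat.log 2 D.gap + 1)
      (.assign out (.bin .add (.bin .mul (.var 10) (entry (const 2) (.var v)))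
        (.bin .mul (isZero (.var 10)) (entry (const 11) (.var 7))))) σ₈
      (Function.update σ₈ out (lastLabel D.κ D.T c (D.start (σ v)) (D.pos (σ v)))) := by
    refine Cmd.Runs.assign hm out ?_
    have hT := h.T_lt (D.array r % 2 ^ D.l)
    have h1 := (eval_var (w := w) (mem := D.mem w S₀) 10).trans e₈.1
    have h2 := eval_entry_const h (f := 2) (by omega) ((eval_var v).trans e₈.2.2) (by omega)
      (show D.start _ < R by omega)
    have h3 := eval_isZero (by omega) h1 (by rw [hb]; split_ifs <;> omega)
    have h4 := eval_entry_const h (f := 11) (by omega) ((eval_var 7).trans e₈.2.1) (by omega) hT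
    rw [lastLabel_eq_array h c hσ]
    change _ = D.start (σ v) at h2
    change _ = D.T (D.array r % 2 ^ D.l) at h4
    change _ = if D.array r < _ then _ else D.T (D.array r % 2 ^ D.l)
    by_cases hlt : D.array r < keyBase D.l D.N D.κ c + D.start (σ v)
    · rw [if_pos hlt] at hb ⊢
      rw [hb] at h1 h3
      have h5 := eval_add (eval_mul h1 h2 (by omega)) (eval_mul h3 h4 (by simp)) (by simp; omega)
      simpa using h5
    · rw [if_neg hlt] at hb ⊢
      rw [hb] at h1 h3
      have h5 := eval_add (eval_mul h1 h2 (by simp)) (eval_mul h3 h4 (by simp; omega))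
        (by simp; omega)
      simpa using h5
  refine ⟨_, .seq run₁ <| .seq run₂ <| .seq run₃ <| .seq run₄ <| .seq run₅ <| .seq run₆ <|
    .seq run₇ <| .seq run₈ run₉, Function.update_self .., fun x hxo hx => ?_⟩
  rw [Function.update_of_ne hxo, hσ₈, Function.update_of_ne (by omega),
    f₇ x (by omega) (by omega), hσ₆, Function.update_of_ne (by omega), hσ₅,
    Function.update_of_ne (by omega), f₄ x (by omega) (by omega), hσ₃,
    Function.update_of_ne (by omega), hσ₂, Function.update_of_ne (by omega), hσ₁,
    Function.update_of_ne (by omega)]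

theorem lastLabel_lt (h : D.Good w R S₀) (c : ℕ) {s : ℕ} (hs : s < R) (r : ℕ) :
    lastLabel D.κ D.T c s r < R := by
  induction r with
  | zero => exact hs
  | succ r ih =>
    rw [lastLabel]
    split_ifs
    · exact h.T_lt r
    · exact ih

/-- The question that the oracle answers. -/
def Answer (D : OracleData) (u v c : ℕ) : Prop :=
  (D.vcol u ≠ c ∧ D.vcol v ≠ c) ∧ D.start u = D.start v ∧
    lastLabel D.κ D.T c (D.start u) (D.pos u) = lastLabel D.κ D.T c (D.start v) (D.pos v)

theorem below_queryCmd : queryCmd.Below 11 := by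
  simp [queryCmd, baseCmd, labelCmd, memberExpr, placeExpr, bucketExpr, hashExpr, headerExpr,
    prefixExpr, Cmd.search, Cmd.Below, Expr.Below, Expr.entry, Expr.eq, Expr.isZero, Expr.lt]

open Classical in
theorem runs_queryCmd (h : D.Good w R S₀) {σ : ℕ → ℕ} (hu : σ 0 < D.n) (hv : σ 1 < D.n)
    (hc : σ 2 ≤ D.C) :
    ∃ τ, Cmd.Runs w (D.mem w S₀) (Nat.log 2 D.gap + 1) queryCmd σ τ ∧
      τ 0 = if D.Answer (σ 0) (σ 1) (σ 2) then 1 else 0 := by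
  have hm : 1 ≤ Nat.log 2 D.gap + 1 := by omega
  have huniv := h.univ
  have hpR := h.p_lt
  have hR := h.R_lt
  have hsize := h.size
  have harr := h.array
  have hw := h.two_le_w
  have hw1 : 1 ≤ w := by omega
  have hverts := h.vertices
  have hcu := h.vcol_le _ hu
  have hcv := h.vcol_le _ hv
  have hsu := h.start_le _ hu
  have hsv := h.start_le _ hv
  have hpow := Nat.two_pow_pos (2 * D.l + 1)
  have hC : D.C < R := by
    refine lt_trans ?_ hpR
    omega
  have run₁ := runs_baseCmd h (σ := σ) hm hc
  obtain ⟨σ₂, run₂, e₂, f₂⟩ := runs_labelCmd h (v := 0) (out := 8) (c := σ 2) (by omega)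
    (σ := Function.update σ 3 (keyBase D.l D.N D.κ (σ 2))) (by simpa using hu) (by simp)
  have g₂ : σ₂ 0 = σ 0 ∧ σ₂ 1 = σ 1 ∧ σ₂ 2 = σ 2 ∧ σ₂ 3 = keyBase D.l D.N D.κ (σ 2) := by
    refine ⟨?_, ?_, ?_, ?_⟩ <;> (rw [f₂ _ (by omega) (by omega)]; simp)
  obtain ⟨σ₃, run₃, e₃, f₃⟩ := runs_labelCmd h (v := 1) (out := 9) (c := σ 2) (σ := σ₂) (by omega)
    (by rw [g₂.2.1]; exact hv) g₂.2.2.2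
  have k0 : σ₃ 0 = σ 0 := (f₃ 0 (by omega) (by omega)).trans g₂.1
  have k1 : σ₃ 1 = σ 1 := (f₃ 1 (by omega) (by omega)).trans g₂.2.1
  have k2 : σ₃ 2 = σ 2 := (f₃ 2 (by omega) (by omega)).trans g₂.2.2.1
  have k8 : σ₃ 8 = lastLabel D.κ D.T (σ 2) (D.start (σ 0)) (D.pos (σ 0)) := by
    rw [f₃ 8 (by omega) (by omega), e₂]; simp
  have k9 : σ₃ 9 = lastLabel D.κ D.T (σ 2) (D.start (σ 1)) (D.pos (σ 1)) := by
    rw [e₃, g₂.2.1]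
  have l8 := lastLabel_lt h (σ 2) (s := D.start (σ 0)) (by omega) (D.pos (σ 0))
  have l9 := lastLabel_lt h (σ 2) (s := D.start (σ 1)) (by omega) (D.pos (σ 1))
  rw [← k8] at l8
  rw [← k9] at l9
  have v0 := (eval_var (w := w) (mem := D.mem w S₀) 0).trans k0
  have v1 := (eval_var (w := w) (mem := D.mem w S₀) 1).trans k1
  have v2 := (eval_var (w := w) (mem := D.mem w S₀) 2).trans k2
  have c0 := eval_entry_const h (f := 3) (by omega) v0 (by omega) (show D.vcol _ < R by omega)
  have c1 := eval_entry_const h (f := 3) (by omega) v1 (by omega) (show D.vcol _ < R by omega)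
  have s0 := eval_entry_const h (f := 2) (by omega) v0 (by omega) (show D.start _ < R by omega)
  have s1 := eval_entry_const h (f := 2) (by omega) v1 (by omega) (show D.start _ < R by omega)
  change _ = D.vcol (σ 0) at c0
  change _ = D.vcol (σ 1) at c1
  change _ = D.start (σ 0) at s0
  change _ = D.start (σ 1) at s1
  have q0 := eval_isZero hw1 (eval_eq hw1 c0 v2 (by omega) (by omega)) (by split_ifs <;> omega)
  have q1 := eval_isZero hw1 (eval_eq hw1 c1 v2 (by omega) (by omega)) (by split_ifs <;> omega)
  have q2 := eval_eq hw1 s0 s1 (by omega) (by omega)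
  have q3 := eval_eq hw1 (eval_var (mem := D.mem w S₀) (σ := σ₃) 8) (eval_var 9) (by omega)
    (by omega)
  have q4 := eval_mul (eval_mul q0 q1 (by split_ifs <;> omega))
    (eval_mul q2 q3 (by split_ifs <;> omega)) (by split_ifs <;> omega)
  refine ⟨_, .seq run₁ <| .seq run₂ <| .seq run₃ <| Cmd.Runs.assign hm 0 q4, ?_⟩
  rw [Function.update_self, k8, k9]
  unfold Answer
  split_ifs <;> first | rfl | (exfalso; tauto)

/-- The memory content is an oracle for the question. -/
theorem Good.isOracle (h : D.Good w R S₀) {K n C : ℕ} (hn : n = D.n) (hC : C ≤ D.C + 1)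
    (hS : 16 * S₀ ≤ K * n) {T : ℕ} (hT : (Nat.log 2 D.gap + 1) * queryCmd.weight ≤ T)
    {Q : Fin n → Fin n → Fin C → Prop} (hQ : ∀ u v c, Q u v c ↔ D.Answer u v c) :
    IsOracle w (queryCmd.code 11 0) (K * n) T Q (D.mem w S₀) := by
  classical
  refine ⟨by rw [mem, length_interleave]; exact hS, fun x hx => lt_of_mem_interleave hx,
    fun u v c => ?_⟩
  obtain ⟨τ, ⟨k, hk, hrun⟩, hτ⟩ := runs_queryCmd h (σ := (WordRAM.init (D.mem w S₀) u v c).reg)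
    (show (u : ℕ) < D.n from hn ▸ u.2) (show (v : ℕ) < D.n from hn ▸ v.2)
    (show (c : ℕ) ≤ D.C by have := c.2; omega)
  change τ 0 = if D.Answer u v c then 1 else 0 at hτ
  refine hrun.decides (hk.trans hT) (by omega) below_queryCmd (fun hq => ?_) (fun hq => ?_)
  · rw [hτ, if_pos ((hQ u v c).mp hq)]
  · rw [hτ, if_neg fun h => hq ((hQ u v c).mpr h)]

end OracleData

end ColorFault

/-! ### Choice of the parameters and space bound -/

namespace ColorFault

open WordRAM

namespace OracleData

/-- The first-level hash range is the number of keys, so it must be positive; the sentinel provides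
a prefix. -/
theorem keys_nonempty (D : OracleData) (hN : D.N + 2 ≤ 2 ^ D.l) : D.keys.Nonempty := by
  obtain ⟨t, -, ht, -⟩ := exists_level (p := IsKey D.l D.N D.κ) (q := D.gap) (B := 2 * D.l)
    (X := 2 ^ (2 * D.l)) (fun s (hs : IsKey D.l D.N D.κ s) => hs.bounds hN) le_rfl
    (Nat.pow_lt_pow_right one_lt_two (by omega)) (Or.inl rfl)
  exact ⟨_, prefix_mem_keys.mpr ((ht t).mpr le_rfl)⟩

theorem card_keys_le (D : OracleData) : D.keys.card ≤ 2 * D.N + 1 + D.gap := by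
  have h1 : (((Finset.range D.N).image D.κ).filter (· ≤ D.C)).card ≤ D.N := by
    refine (Finset.card_filter_le _ _).trans (Finset.card_image_le.trans ?_)
    rw [Finset.card_range]
  have h2 := Finset.card_image_le (s := prefixes (IsKey D.l D.N D.κ) D.gap (2 * D.l))
    (f := (D.C + 1 + ·))
  have h3 := card_prefixes_le (p := IsKey D.l D.N D.κ) (q := D.gap) (B := 2 * D.l) le_rfl
  have h4 := count_isKey_le (l := D.l) (N := D.N) (κ := D.κ) (2 ^ (2 * D.l + 1))
  have h5 := Finset.card_union_le (((Finset.range D.N).image D.κ).filter (· ≤ D.C))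
    ((prefixes (IsKey D.l D.N D.κ) D.gap (2 * D.l)).image (D.C + 1 + ·))
  unfold keys
  omega

end OracleData

/-- A sequence of at most `2 * n` colored and labelled positions gives an oracle. -/
theorem exists_oracle {n C w N : ℕ} (hn : 0 < n) (hw : 32 * (Nat.log 2 (n + C) + 1) ≤ w)
    (hN : N ≤ 2 * n) {κ T pos start vcol : ℕ → ℕ} (hpos : ∀ u < n, pos u < N)
    (hstart : ∀ u < n, start u ≤ N) (hvcol : ∀ u < n, vcol u ≤ C) (hT : ∀ i, T i ≤ 4 * n)
    {Q : Fin n → Fin n → Fin C → Prop}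
    (hQ : ∀ u v c, Q u v c ↔ (vcol u ≠ c ∧ vcol v ≠ c) ∧ start u = start v ∧
      lastLabel κ T c (start u) (pos u) = lastLabel κ T c (start v) (pos v)) :
    ∃ mem : List ℕ, IsOracle w (queryCmd.code 11 0) ((3200 + 5 * queryCmd.weight) * n)
      ((3200 + 5 * queryCmd.weight) * (Nat.log 2 (Nat.log 2 n) + 1)) Q mem := by
  set g := Nat.log 2 n with hg
  have hg1 : 2 ^ g ≤ n := Nat.pow_log_le_self 2 hn.ne'
  have hg2 : n < 2 ^ (g + 1) := Nat.lt_pow_succ_log_self one_lt_two n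
  have hgn : g < n := Nat.lt_two_pow_self.trans_le hg1
  obtain ⟨M, hM⟩ : ∃ M, M = 2 ^ (Nat.log 2 (n + C) + 1) := ⟨_, rfl⟩
  have hnM : n + C < M := hM ▸ Nat.lt_pow_succ_log_self one_lt_two _
  have hM2 : 2 ≤ M := by
    rw [hM, pow_succ]
    have := Nat.two_pow_pos (Nat.log 2 (n + C))
    omega
  have hl : 2 ^ (g + 3) = 4 * 2 ^ (g + 1) := by rw [pow_succ, pow_succ 2 (g + 1)]; ring
  have hNl : N + 2 ≤ 2 ^ (g + 3) := by omega
  obtain ⟨p, hp, hp1, hp2⟩ := Nat.exists_prime_lt_and_le_two_mul (C + 1 + 2 ^ (2 * (g + 3) + 1))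
    (by positivity)
  have hpow : 2 ^ (2 * (g + 3) + 1) ≤ 128 * (n * n) := by
    have : 2 ^ (2 * (g + 3) + 1) = 128 * (2 ^ g * 2 ^ g) := by
      rw [pow_succ, pow_mul', pow_two, pow_add]; ring
    rw [this]
    exact Nat.mul_le_mul_left _ (Nat.mul_le_mul hg1 hg1)
  have hpow0 := Nat.two_pow_pos (2 * (g + 3))
  have hMk : ∀ k, 2 ^ k ≤ M ^ k := fun k => Nat.pow_le_pow_left hM2 k
  have hpR : p < M ^ 13 := by
    have h1 : n * n ≤ M ^ 2 := by rw [pow_two]; exact Nat.mul_le_mul (by omega) (by omega)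
    have h2 : 258 * M ^ 2 < 2 ^ 11 * M ^ 2 := by
      have : 0 < M ^ 2 := by positivity
      omega
    have h3 : 2 ^ 11 * M ^ 2 ≤ M ^ 13 := by
      calc _ ≤ M ^ 11 * M ^ 2 := Nat.mul_le_mul_right _ (hMk 11)
        _ = M ^ 13 := by ring
    have h4 : M ≤ M ^ 2 := Nat.le_self_pow (by omega) M
    omega
  have hnR : 4000 * n ≤ M ^ 13 := by
    calc 4000 * n ≤ 2 ^ 12 * M := Nat.mul_le_mul (by norm_num) (by omega)
      _ ≤ M ^ 12 * M := Nat.mul_le_mul_right _ (hMk 12)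
      _ = M ^ 13 := by ring
  -- All stored numbers stay below `R = M ^ 13`. The word length factor `32` leaves room for
  -- products of two of them.
  have hsq : 4 * (M ^ 13 * M ^ 13) ≤ 2 ^ w := by
    calc 4 * (M ^ 13 * M ^ 13) ≤ M ^ 2 * (M ^ 13 * M ^ 13) := Nat.mul_le_mul_right _ (hMk 2)
      _ = M ^ 28 := by ring
      _ ≤ M ^ 32 := Nat.pow_le_pow_right (by omega) (by omega)
      _ = 2 ^ (32 * (Nat.log 2 (n + C) + 1)) := by rw [hM, ← pow_mul, mul_comm]
      _ ≤ 2 ^ w := Nat.pow_le_pow_right two_pos hw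
  obtain ⟨R, hR⟩ : ∃ R, R = M ^ 13 := ⟨_, rfl⟩
  -- `200 * n` exceeds seven times the number of dictionary keys; the `16` tables then take `3200 *
  -- n` words.
  obtain ⟨S₀, hS₀⟩ : ∃ S₀, S₀ = 200 * n := ⟨_, rfl⟩
  rw [← hR] at hpR hnR hsq
  -- The keys do not depend on the hash parameters, so they can be read off with zeros in their
  -- place before the hash functions are chosen.
  let D₀ : OracleData := ⟨n, C, N, g + 3, 0, 0, 0, 0, 0, 0, κ, T, pos, start, vcol⟩
  have hcard := D₀.card_keys_le
  change D₀.keys.card ≤ 2 * N + 1 + (2 * (g + 3) + 2) at hcard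
  have hne := D₀.keys_nonempty hNl
  have hlt : ∀ x ∈ D₀.keys, x < p := fun x hx =>
    OracleData.lt_p_of_mem_keys (D := { D₀ with p := p }) hp1 hx
  obtain ⟨X, hX⟩ : ∃ X, X = D₀.keys := ⟨_, rfl⟩
  rw [← hX] at hcard hne hlt
  obtain ⟨a, A, S, O, ha, hA, hS, hO, hslot, hinj⟩ := exists_perfect_hash hp X hlt hne
  obtain ⟨k, hk⟩ : ∃ k, k = X.card := ⟨_, rfl⟩
  have hk0 := hne.card_pos
  rw [← hk] at hcard hS hO hslot hinj hk0
  have hplace : ∀ x, slot p k a A S O x < S₀ := fun x =>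
    lt_of_lt_of_le (hslot x) (by omega)
  let D : OracleData := ⟨n, C, N, g + 3, p, a, k, A, S, O, κ, T, pos, start, vcol⟩
  have hkeys : X = D.keys := hX
  have hhalf := D.half_bounds.1
  have hgap : D.gap = 2 * (g + 3) + 2 := rfl
  have hgood : D.Good w R S₀ := by
    have hhalfS : N + 1 + D.half < S₀ := by omega
    have hnS : n ≤ S₀ := by omega
    have hsS : k ≤ S₀ := by omega
    have hTR : ∀ i, T i < R := fun i => (hT i).trans_lt (by omega)
    have hSR : ∀ i < k, S i < R := fun i hi => lt_of_le_of_lt (hS i hi).2 (by omega)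
    have hOR : ∀ i < k, O i < R := fun i hi => lt_of_le_of_lt (hO i hi) (by omega)
    have hS6 : 6 ≤ S₀ := by omega
    have hSS : 16 * S₀ + 16 ≤ R := by omega
    exact { sq := hsq, size := hSS, header := hS6, N_lt := hNl, univ := hp1, p_lt := hpR,
            s_pos := hk0, s_le := hsS, a_lt := ha, A_lt := hA, S_lt := hSR, O_lt := hOR,
            place_lt := hplace, injOn := hkeys ▸ hinj, array := hhalfS, vertices := hnS, pos_lt := hpos,
            start_le := hstart, vcol_le := hvcol, T_lt := hTR }
  refine ⟨_, hgood.isOracle rfl (Nat.le_succ C) (by nlinarith) ?_ hQ⟩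
  set L := Nat.log 2 g with hL
  have hL2 : g < 2 ^ (L + 1) := Nat.lt_pow_succ_log_self one_lt_two g
  have hlog : Nat.log 2 D.gap < L + 5 := by
    refine Nat.log_lt_of_lt_pow (by omega) ?_
    rw [pow_add, hgap]
    rw [pow_succ] at hL2
    have := Nat.two_pow_pos L
    omega
  nlinarith [Nat.mul_le_mul_right queryCmd.weight (show Nat.log 2 D.gap + 1 ≤ 5 * (L + 1) by omega)]

end ColorFault

/-! ### Covering walks of the components -/

namespace ColorFault

open Relation

section Tour

variable {V : Type*} {r : V → V → Prop}

theorem reflTransGen_symm (hr : ∀ a b, r a b → r b a) {a b : V} (h : ReflTransGen r a b) :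
    ReflTransGen r b a := by
  induction h with
  | refl => exact .refl
  | tail _ h ih => exact .head (hr _ _ h) ih

/-- A component has a covering walk that is less than twice as long as the component is large. -/
theorem exists_covering_walk [Fintype V] [DecidableEq V] (hr : ∀ a b, r a b → r b a) (x : V) :
    ∃ W : List V, W.IsChain r ∧ W.length ≤ 2 * W.toFinset.card ∧
      ∀ y, y ∈ W ↔ ReflTransGen r x y := by
  have key : ∀ k, ∃ W : List V, x ∈ W ∧ W.IsChain r ∧ W.length ≤ 2 * W.toFinset.card ∧
      (∀ y ∈ W, ReflTransGen r x y) ∧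
      (k ≤ W.toFinset.card ∨ ∀ y, ReflTransGen r x y → y ∈ W) := by
    intro k
    induction k with
    | zero => exact ⟨[x], by simp, by simp, by simp, by simp [ReflTransGen.refl], Or.inl (by simp)⟩
    | succ k ih =>
      obtain ⟨W, hx, hW, hlen, hreach, hk⟩ := ih
      by_cases hcov : ∀ y, ReflTransGen r x y → y ∈ W
      · exact ⟨W, hx, hW, hlen, hreach, Or.inr hcov⟩
      obtain ⟨a, b, ha, hb, hab⟩ : ∃ a b, a ∈ W ∧ b ∉ W ∧ r a b := by
        by_contra! hno
        refine hcov fun y hy => ?_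
        induction hy with
        | refl => exact hx
        | tail _ h ih =>
          by_contra hb
          exact hno _ _ ih hb h
      -- The detour `a, b, a` in place of `a` costs two positions and gains the new vertex `b`.
      obtain ⟨W₁, W₂, rfl⟩ := List.append_of_mem ha
      have hfin : (W₁ ++ a :: b :: a :: W₂).toFinset = insert b (W₁ ++ a :: W₂).toFinset := by
        ext y
        simp only [List.mem_toFinset, List.mem_append, List.mem_cons, Finset.mem_insert]
        tauto
      have hcard : (W₁ ++ a :: b :: a :: W₂).toFinset.card = (W₁ ++ a :: W₂).toFinset.card + 1 := by
        rw [hfin, Finset.card_insert_of_notMem (by rwa [List.mem_toFinset])]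
      refine ⟨W₁ ++ a :: b :: a :: W₂, ?_, ?_, ?_, ?_, Or.inl ?_⟩
      · simp only [List.mem_append, List.mem_cons] at hx ⊢
        tauto
      · rw [List.isChain_split] at hW ⊢
        exact ⟨hW.1, by
          rw [List.isChain_cons_cons, List.isChain_cons_cons]
          exact ⟨hab, hr _ _ hab, hW.2⟩⟩
      · rw [hcard]
        simp only [List.length_append, List.length_cons] at hlen ⊢
        omega
      · intro y hy
        have hy' : y ∈ (W₁ ++ a :: b :: a :: W₂).toFinset := List.mem_toFinset.mpr hy
        rw [hfin, Finset.mem_insert, List.mem_toFinset] at hy'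
        rcases hy' with rfl | hy'
        · exact (hreach a ha).tail hab
        · exact hreach y hy'
      · rw [hcard]
        have := hk.resolve_right hcov
        omega
  -- More vertices than `V` has are impossible, so the walk is covering.
  obtain ⟨W, -, hW, hlen, hreach, hk⟩ := key (Fintype.card V + 1)
  refine ⟨W, hW, hlen, fun y => ⟨hreach y, hk.resolve_left ?_ y⟩⟩
  have := Finset.card_le_univ W.toFinset
  omega

/-- Covering walks of the components, one after the other: vertex `u` is at position `pos u`, and
the walk of its component begins at position `start u`. -/
theorem exists_tour [Fintype V] (hr : ∀ a b, r a b → r b a) [Nonempty V] :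
    ∃ (N : ℕ) (v : ℕ → V) (pos start : V → ℕ), N ≤ 2 * Fintype.card V ∧
      (∀ u, v (pos u) = u ∧ start u ≤ pos u ∧ pos u < N) ∧
      (∀ u i, start u ≤ i → i < pos u → r (v i) (v (i + 1))) ∧
      ∀ u u', start u = start u' ↔ ReflTransGen r u u' := by
  classical
  -- `A` is a union of components whose walks are in place; one more component is appended from
  -- position `N` on, and `idxOf` gives its vertices their positions.
  have key : ∀ k, ∃ (A : Finset V) (N : ℕ) (v : ℕ → V) (pos start : V → ℕ),
      (∀ a ∈ A, ∀ b, ReflTransGen r a b → b ∈ A) ∧ N ≤ 2 * A.card ∧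
      (∀ u ∈ A, v (pos u) = u ∧ start u ≤ pos u ∧ pos u < N) ∧
      (∀ u ∈ A, ∀ i, start u ≤ i → i < pos u → r (v i) (v (i + 1))) ∧
      (∀ u ∈ A, ∀ u' ∈ A, start u = start u' ↔ ReflTransGen r u u') ∧
      (k ≤ A.card ∨ A = Finset.univ) := by
    intro k
    induction k with
    | zero =>
      exact ⟨∅, 0, fun _ => Classical.arbitrary V, 0, 0, by simp, by simp, by simp, by simp,
        by simp, Or.inl (by simp)⟩
    | succ k ih =>
      obtain ⟨A, N, v, pos, start, hcl, hN, hpos, hstep, hstart, hk⟩ := ih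
      by_cases huniv : A = Finset.univ
      · exact ⟨A, N, v, pos, start, hcl, hN, hpos, hstep, hstart, Or.inr huniv⟩
      obtain ⟨x, hx⟩ : ∃ x, x ∉ A := by
        by_contra! h
        exact huniv (Finset.eq_univ_iff_forall.mpr h)
      obtain ⟨W, hW, hlen, hmem⟩ := exists_covering_walk hr x
      have hxW : x ∈ W := (hmem x).mpr .refl
      have hdisj : ∀ y ∈ W, y ∉ A := fun y hy hyA =>
        hx (hcl y hyA x (reflTransGen_symm hr ((hmem y).mp hy)))
      have hcard : (A ∪ W.toFinset).card = A.card + W.toFinset.card :=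
        Finset.card_union_of_disjoint (Finset.disjoint_right.mpr fun y hy =>
          hdisj y (List.mem_toFinset.mp hy))
      have hWpos : 0 < W.toFinset.card :=
        Finset.card_pos.mpr ⟨x, List.mem_toFinset.mpr hxW⟩
      refine ⟨A ∪ W.toFinset, N + W.length, fun i => if i < N then v i else W.getD (i - N) x,
        fun u => if u ∈ A then pos u else N + W.idxOf u,
        fun u => if u ∈ A then start u else N, ?_, by omega, ?_, ?_, ?_, Or.inl ?_⟩
      · intro a ha b hab
        rw [Finset.mem_union, List.mem_toFinset] at ha ⊢
        rcases ha with ha | ha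
        · exact Or.inl (hcl a ha b hab)
        · exact Or.inr ((hmem b).mpr (((hmem a).mp ha).trans hab))
      · intro u hu
        rw [Finset.mem_union, List.mem_toFinset] at hu
        by_cases huA : u ∈ A
        · obtain ⟨h1, h2, h3⟩ := hpos u huA
          simp only [huA, if_true, h3]
          exact ⟨h1, h2, by omega⟩
        · have hi := List.idxOf_lt_length_iff.mpr (hu.resolve_left huA)
          simp only [huA, if_false]
          refine ⟨?_, by omega, by omega⟩
          rw [if_neg (by omega), Nat.add_sub_cancel_left, List.getD_eq_getElem _ _ hi,
            List.getElem_idxOf]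
      · intro u hu i
        rw [Finset.mem_union, List.mem_toFinset] at hu
        by_cases huA : u ∈ A
        · obtain ⟨h1, h2, h3⟩ := hpos u huA
          simp only [huA, if_true]
          intro hi hi'
          rw [if_pos (by omega), if_pos (by omega)]
          exact hstep u huA i hi hi'
        · have hi := List.idxOf_lt_length_iff.mpr (hu.resolve_left huA)
          simp only [huA, if_false]
          intro hi1 hi2
          obtain ⟨j, rfl⟩ := Nat.exists_eq_add_of_le hi1
          rw [if_neg (by omega), if_neg (by omega), Nat.add_sub_cancel_left, add_assoc,
            Nat.add_sub_cancel_left, List.getD_eq_getElem _ _ (by omega),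
            List.getD_eq_getElem _ _ (by omega)]
          exact List.isChain_iff_getElem.mp hW j (by omega)
      · intro u hu u' hu'
        rw [Finset.mem_union, List.mem_toFinset] at hu hu'
        by_cases huA : u ∈ A <;> by_cases huA' : u' ∈ A <;>
          simp only [huA, huA', if_true, if_false]
        · exact hstart u huA u' huA'
        · obtain ⟨h1, h2, h3⟩ := hpos u huA
          exact ⟨fun h => by omega, fun h => absurd (hcl u huA u' h) huA'⟩
        · obtain ⟨h1, h2, h3⟩ := hpos u' huA'
          exact ⟨fun h => by omega, fun h => absurd (hcl u' huA' u (reflTransGen_symm hr h)) huA⟩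
        · exact ⟨fun _ => (reflTransGen_symm hr ((hmem u).mp (hu.resolve_left huA))).trans
            ((hmem u').mp (hu'.resolve_left huA')), fun _ => trivial⟩
      · have := hk.resolve_right huniv
        omega
  obtain ⟨A, N, v, pos, start, -, hN, hpos, hstep, hstart, hk⟩ := key (Fintype.card V + 1)
  have hA : A = Finset.univ := hk.resolve_left fun h => by
    have := Finset.card_le_univ A
    omega
  subst hA
  exact ⟨N, v, pos, start, hN, fun u => hpos u (Finset.mem_univ u),
    fun u => hstep u (Finset.mem_univ u),
    fun u u' => hstart u (Finset.mem_univ u) u' (Finset.mem_univ u')⟩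

end Tour

/-! ### From the tour to the connectivity oracle -/

/-- The smallest vertex that is connected to `x`. -/
noncomputable def rep {n : ℕ} (r : Fin n → Fin n → Prop) (x : Fin n) : ℕ :=
  sInf {m | ∃ y : Fin n, (y : ℕ) = m ∧ ReflTransGen r x y}

theorem rep_mem {n : ℕ} (r : Fin n → Fin n → Prop) (x : Fin n) :
    ∃ y : Fin n, (y : ℕ) = rep r x ∧ ReflTransGen r x y :=
  Nat.sInf_mem (s := {m | ∃ y : Fin n, (y : ℕ) = m ∧ ReflTransGen r x y}) ⟨x, x, rfl, .refl⟩

theorem rep_eq_iff {n : ℕ} {r : Fin n → Fin n → Prop} (hr : ∀ a b, r a b → r b a) {x y : Fin n} :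
    rep r x = rep r y ↔ ReflTransGen r x y := by
  constructor
  · intro h
    obtain ⟨a, ha, hxa⟩ := rep_mem r x
    obtain ⟨b, hb, hyb⟩ := rep_mem r y
    obtain rfl : a = b := Fin.ext (by omega)
    exact hxa.trans (reflTransGen_symm hr hyb)
  · intro h
    unfold rep
    congr 1
    ext m
    exact ⟨fun ⟨z, hz, hxz⟩ => ⟨z, hz, (reflTransGen_symm hr h).trans hxz⟩,
      fun ⟨z, hz, hyz⟩ => ⟨z, hz, h.trans hyz⟩⟩

open Classical in
/-- An oracle for connectivity under subrelations `r' c` of `r`. A step of `r` breaks for one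
color only, if its end survives. -/
theorem exists_connectivity_oracle {n C w : ℕ} (hw : 32 * (Nat.log 2 (n + C) + 1) ≤ w)
    {r : Fin n → Fin n → Prop} (hr : ∀ a b, r a b → r b a)
    {r' : Fin C → Fin n → Fin n → Prop} (hr' : ∀ c a b, r' c a b → r' c b a)
    (hsub : ∀ c a b, r' c a b → r a b) {vcol : Fin n → ℕ} (hvcol : ∀ a, vcol a ≤ C)
    (hbreak : ∀ a b, r a b → ∃ k : ℕ, ∀ c : Fin C, k ≠ c → vcol b ≠ c → vcol a ≠ c ∧ r' c a b)
    {Q : Fin n → Fin n → Fin C → Prop}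
    (hQ : ∀ u v c, Q u v c ↔ (vcol u ≠ c ∧ vcol v ≠ c) ∧ ReflTransGen (r' c) u v) :
    ∃ mem : List ℕ, IsOracle w (queryCmd.code 11 0) ((3200 + 5 * queryCmd.weight) * n)
      ((3200 + 5 * queryCmd.weight) * (Nat.log 2 (Nat.log 2 n) + 1)) Q mem := by
  rcases Nat.eq_zero_or_pos n with rfl | hn
  · exact ⟨[], by simp, by simp, fun u => u.elim0⟩
  have : Nonempty (Fin n) := ⟨⟨0, hn⟩⟩
  obtain ⟨N, v, pos, start, hN, hpos, hstep, hstart⟩ := exists_tour hr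
  rw [Fintype.card_fin] at hN
  choose brk hbrk using hbreak
  -- The default color `0` does no harm: labels only look at positions between `start u` and `pos
  -- u`, where every step belongs to `r`.
  let κ : ℕ → ℕ := fun i => if h : r (v i) (v (i + 1)) then brk _ _ h else 0
  -- The part that contains the start of the walk must be called `start x`, the value of `lastLabel`
  -- if nothing breaks. The shift by `N` keeps the other names apart from it.
  let label : Fin C → Fin n → ℕ := fun c x =>
    if ReflTransGen (r' c) (v (start x)) x then start x else N + rep (r' c) x
  let T : ℕ → ℕ := fun i => if h : κ i < C then label ⟨κ i, h⟩ (v (i + 1)) else 0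
  have hmono : ∀ {c a b}, ReflTransGen (r' c) a b → start a = start b := fun {c a b} h =>
    (hstart a b).mpr (ReflTransGen.mono (hsub c) _ _ h)
  have hlabel : ∀ c a b, start a = start b →
      (label c a = label c b ↔ ReflTransGen (r' c) a b) := by
    intro c a b hab
    simp only [label, ← hab]
    have hlt : start a < N := (hpos a).2.1.trans_lt (hpos a).2.2
    by_cases ha : ReflTransGen (r' c) (v (start a)) a <;>
      by_cases hb : ReflTransGen (r' c) (v (start a)) b <;>
      simp only [ha, hb, if_true, if_false]
    · exact ⟨fun _ => (reflTransGen_symm (hr' c) ha).trans hb, fun _ => trivial⟩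
    · exact ⟨fun h => by omega, fun h => absurd (ha.trans h) hb⟩
    · exact ⟨fun h => by omega, fun h => absurd (hb.trans (reflTransGen_symm (hr' c) h)) ha⟩
    · rw [Nat.add_left_cancel_iff, rep_eq_iff (hr' c)]
  have hlast : ∀ (x : Fin n) (c : Fin C) (d : ℕ), start x + d ≤ pos x →
      vcol (v (start x + d)) ≠ c →
      lastLabel κ T c (start x) (start x + d) = label c (v (start x + d)) := by
    intro x c d
    have hsame : ∀ d, start x + d ≤ pos x → start (v (start x + d)) = start x := by
      intro d hd
      refine (hstart _ _).mpr ?_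
      obtain ⟨e, he⟩ := Nat.exists_eq_add_of_le hd
      have : ∀ e, start x + d + e ≤ pos x →
          ReflTransGen r (v (start x + d)) (v (start x + d + e)) := by
        intro e
        induction e with
        | zero => exact fun _ => .refl
        | succ e ih => exact fun h => (ih (by omega)).tail (hstep x _ (by omega) (by omega))
      have h := this e he.ge
      rwa [← he, (hpos x).1] at h
    induction d with
    | zero =>
      intro hd _
      rw [lastLabel_of_none fun j hj hj' => by omega]
      have h0 := hsame 0 hd
      rw [add_zero] at h0 ⊢
      simp only [label, h0]
      rw [if_pos .refl]
    | succ d ih =>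
      intro hd hc
      rw [← add_assoc] at hd hc ⊢
      have hrel := hstep x (start x + d) (by omega) (by omega)
      have hκ : κ (start x + d) = brk _ _ hrel := dif_pos hrel
      rw [lastLabel]
      split_ifs with h
      -- The step is charged to `c`: the label stored with it is by definition that of its end after
      -- the failure of `c`.
      · have hlt : κ (start x + d) < C := by rw [h.2]; exact c.2
        simp only [T, dif_pos hlt]
        congr 1
        exact Fin.ext h.2
      -- The step is not charged to `c`: its first end survives too, and the step stays in `r' c`,
      -- so the label carries over.
      · have hne : κ (start x + d) ≠ c := fun h' => h ⟨by omega, h'⟩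
        obtain ⟨h1, h2⟩ := hbrk _ _ hrel c (hκ ▸ hne) hc
        rw [ih (by omega) h1]
        refine (hlabel c _ _ ?_).mpr (.single h2)
        rw [hsame d (by omega)]
        exact (hsame (d + 1) hd).symm
  have hlast' : ∀ (x : Fin n) (c : Fin C), vcol x ≠ c →
      lastLabel κ T c (start x) (pos x) = label c x := by
    intro x c hc
    obtain ⟨h1, h2, -⟩ := hpos x
    have h := hlast x c (pos x - start x) (by omega)
    rw [Nat.add_sub_cancel' h2, h1] at h
    exact h hc
  have hrep : ∀ c x, label c x ≤ 4 * n := by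
    intro c x
    obtain ⟨y, hy, -⟩ := rep_mem (r' c) x
    have := y.2
    have := hpos x
    simp only [label]
    split_ifs <;> omega
  let ext : (Fin n → ℕ) → ℕ → ℕ := fun f i => if h : i < n then f ⟨i, h⟩ else 0
  have hext : ∀ f (u : Fin n), ext f u = f u := fun f u => dif_pos u.2
  refine exists_oracle hn hw hN (κ := κ) (T := T) (pos := ext pos) (start := ext start)
    (vcol := ext vcol) (fun u hu => ?_) (fun u hu => ?_) (fun u hu => ?_) (fun i => ?_)
    (fun u v c => ?_)
  · exact (hext pos ⟨u, hu⟩).trans_lt (hpos _).2.2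
  · exact (hext start ⟨u, hu⟩).trans_le ((hpos _).2.1.trans (hpos _).2.2.le)
  · exact (hext vcol ⟨u, hu⟩).trans_le (hvcol _)
  · simp only [T]
    split_ifs
    · exact hrep _ _
    · exact Nat.zero_le _
  · simp only [hext]
    rw [hQ]
    refine and_congr_right fun ⟨hu, hv⟩ => ?_
    rw [hlast' u c hu, hlast' v c hv]
    exact ⟨fun h => ⟨hmono h, (hlabel c u v (hmono h)).mpr h⟩, fun h => (hlabel c u v h.1).mp h.2⟩

end ColorFault

/-! ### Edge colors and vertex colors as instances -/

theorem theorem3p6 :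
    (∃ (P : WordRAM.Program) (a K : ℕ),
      ∀ (n C : ℕ) (β : Type*) (G : Graph (Fin n) β), G.vertexSet = Set.univ →
      ∀ (color : β → Fin C) (w : ℕ), a * (Nat.log 2 (n + C) + 1) ≤ w →
        ∃ mem : List ℕ,
          ColorFault.IsOracle w P (K * n) (K * (Nat.log 2 (Nat.log 2 n) + 1))
            (fun u v c => ColorFault.ConnectedIn (ColorFault.minusEdgeColor G color c) u v) mem) ∧
    (∃ (P : WordRAM.Program) (a K : ℕ),
      ∀ (n C : ℕ) (β : Type*) (G : Graph (Fin n) β), G.vertexSet = Set.univ →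
      ∀ (color : Fin n → Fin C) (w : ℕ), a * (Nat.log 2 (n + C) + 1) ≤ w →
        ∃ mem : List ℕ,
          ColorFault.IsOracle w P (K * n) (K * (Nat.log 2 (Nat.log 2 n) + 1))
            (fun u v c => ColorFault.ConnectedIn (ColorFault.minusVertexColor G color c) u v)
            mem) := by
  refine ⟨⟨ColorFault.queryCmd.code 11 0, 32, 3200 + 5 * ColorFault.queryCmd.weight,
    fun n C β G hG color w hw => ?_⟩, ⟨ColorFault.queryCmd.code 11 0, 32,
    3200 + 5 * ColorFault.queryCmd.weight, fun n C β G hG color w hw => ?_⟩⟩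
  -- Vertices get the color `C`, which is never queried, so all of them survive.
  · refine ColorFault.exists_connectivity_oracle hw (r := G.Adj)
      (r' := fun c => (ColorFault.minusEdgeColor G color c).Adj) (vcol := fun _ => C)
      (fun a b h => h.symm) (fun c a b h => h.symm) ?_ (fun _ => le_rfl) ?_ ?_
    · rintro c a b ⟨e, he⟩
      exact ⟨e, ((Graph.deleteEdges_isLink ..).mp he).1⟩
    · rintro a b ⟨e, he⟩
      -- One of possibly many parallel edges is enough: a failure of its color counts as a break
      -- even if another edge survives, since the label after the break is recorded correctly in any
      -- case.
      refine ⟨color e, fun c hc _ => ⟨c.2.ne', e, (Graph.deleteEdges_isLink ..).mpr ⟨he, fun h => ?_⟩⟩⟩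
      exact hc (congrArg Fin.val h)
    · intro u v c
      have hV : (ColorFault.minusEdgeColor G color c).vertexSet = Set.univ := hG
      simp [ColorFault.ConnectedIn, hV, c.2.ne']
  · refine ColorFault.exists_connectivity_oracle hw (r := G.Adj)
      (r' := fun c => (ColorFault.minusVertexColor G color c).Adj) (vcol := fun x => color x)
      (fun a b h => h.symm) (fun c a b h => h.symm) ?_ (fun x => (color x).2.le) ?_ ?_
    · rintro c a b ⟨e, he⟩
      exact ⟨e, ((Graph.deleteVerts_isLink _ _).mp he).1⟩
    · rintro a b ⟨e, he⟩
      exact ⟨color a, fun c ha hb => ⟨ha, e, (Graph.deleteVerts_isLink _ _).mpr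
        ⟨he, fun h => ha (congrArg Fin.val h), fun h => hb (congrArg Fin.val h)⟩⟩⟩
    · intro u v c
      have hV : ∀ x, x ∈ (ColorFault.minusVertexColor G color c).vertexSet ↔
          (color x : ℕ) ≠ c := by
        intro x
        rw [ColorFault.minusVertexColor, Graph.vertexSet_deleteVerts, hG]
        simp [Fin.ext_iff]
      rw [ColorFault.ConnectedIn, hV, hV, and_assoc]
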